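/- For probability distributions $p,q$ on $[n]$ write $\|p-q\| := \frac12\sum_{x\in[n]}|p(x)-q(x)|$. A unitary $A$ on the space with finite orthonormal basis $\{|s\rangle : s\in S\}$, with a start element $s_0\in S$ and an output map $\varphi:S\to[n]$, is said to sample from $p$ if $p(x)=\sum_{s:\varphi(s)=x}|\langle s|A|s_0\rangle|^2$ for all $x\in[n]$. A quantum algorithm with sampling access to $p$ and $q$ consists of an initial basis state on registers with bases $S$, $T$ and a finite workspace, a fixed finite sequence of steps, each of which is either a unitary independent of $p$, $q$, $A$, $B$ or one application of one of $A, A^{-1}$ (on the $S$-register) or $B, B^{-1}$ (on the $T$-register), where $A$ samples from $p$ and $B$ samples from $q$, and a final measurement in the computational basis whose outcome determines the real number that is output; its number of samples is the total number of applications of $A,A^{-1},B,B^{-1}$. Theorem. There is a universal constant $C>0$ such that for all $n$, all $0<\epsilon<1$, $0<\delta<1$, all finite $S,T$, start elements $s_0\in S$, $t_0\in T$ and output maps $\varphi:S\to[n]$, $\psi:T\to[n]$, there is a quantum algorithm that uses at most \[ C\,\frac{\sqrt n}{\epsilon^{3/2}}\,\log(1/\epsilon)\,\log(1/\delta) \]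 samples and such that, for all distributions $p,q$ on $[n]$ and all unitaries $A$, $B$ that sample from $p$ (with $s_0,\varphi$) and from $q$ (with $t_0,\psi$) respectively, it outputs, with probability at least $1-\delta$, a number $\widetilde d$ with $|\widetilde d-\|p-q\||\le\epsilon$. Moreover, for small $\epsilon$ and $\delta$ this improves the bound $O(\sqrt n/(\epsilon^8\delta^5))$ of Bravyi, Harrow and Hassidim: for every $n$, \[ \frac{\sqrt n}{\epsilon^{3/2}}\log(1/\epsilon)\log(1/\delta) = o\!\left(\frac{\sqrt n}{\epsilon^8\delta^5}\right)\quad\text{as } \epsilon,\delta\to0^+ . \] -/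

import Mathlib

open scoped Kronecker Topology

/-- `p` is a probability distribution on the `n` elements of `Fin n`. -/
def IsDistribution {n : ℕ} (p : Fin n → ℝ) : Prop :=
  (∀ x, 0 ≤ p x) ∧ ∑ x, p x = 1

/-- The total variation distance `‖p - q‖ = (1/2) ∑ₓ |p(x) - q(x)|`. -/
noncomputable def tvDist {n : ℕ} (p q : Fin n → ℝ) : ℝ :=
  (1 / 2) * ∑ x, |p x - q x|

/-- The unitary `A`, acting on the space with orthonormal (computational) basis `S`, samples from
`p`: applying `A` to the basis state `s₀`, measuring in the computational basis and outputting
`φ s` on outcome `s` gives each `x` with probability `p x`. Measuring only a part of the registers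
is the case where `φ` depends only on that part. -/
def SamplesFrom {n : ℕ} {S : Type*} [Fintype S] [DecidableEq S]
    (A : Matrix.unitaryGroup S ℂ) (s₀ : S) (φ : S → Fin n) (p : Fin n → ℝ) : Prop :=
  ∀ x, p x = ∑ s with φ s = x, ‖(A : Matrix S S ℂ) s s₀‖ ^ 2

/-- One step of a quantum algorithm with access to two unknown unitaries, one acting on a register
with basis `S` and one acting on a register with basis `T`, and with a further workspace register
with basis `W`: either a fixed unitary on all registers, or one use of one of the unknown
unitaries or of its inverse. -/
inductive QStep (S T W : Type*) [Fintype S] [DecidableEq S] [Fintype T] [DecidableEq T]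
    [Fintype W] [DecidableEq W] where
  | fixed (U : Matrix.unitaryGroup (S × T × W) ℂ)
  | useA
  | useAInv
  | useB
  | useBInv

/-- The operator that a step performs when the unknown unitaries are `A` and `B`. -/
noncomputable def QStep.op {S T W : Type*} [Fintype S] [DecidableEq S] [Fintype T] [DecidableEq T]
    [Fintype W] [DecidableEq W] (A : Matrix.unitaryGroup S ℂ) (B : Matrix.unitaryGroup T ℂ) :
    QStep S T W → Matrix (S × T × W) (S × T × W) ℂ
  | .fixed U => (U : Matrix (S × T × W) (S × T × W) ℂ)
  | .useA => (A : Matrix S S ℂ) ⊗ₖ (1 : Matrix (T × W) (T × W) ℂ)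
  | .useAInv => ((A⁻¹ : Matrix.unitaryGroup S ℂ) : Matrix S S ℂ) ⊗ₖ (1 : Matrix (T × W) (T × W) ℂ)
  | .useB => (1 : Matrix S S ℂ) ⊗ₖ ((B : Matrix T T ℂ) ⊗ₖ (1 : Matrix W W ℂ))
  | .useBInv => (1 : Matrix S S ℂ) ⊗ₖ
      (((B⁻¹ : Matrix.unitaryGroup T ℂ) : Matrix T T ℂ) ⊗ₖ (1 : Matrix W W ℂ))

/-- The number of uses of the unknown unitaries and their inverses in a step. -/
def QStep.cost {S T W : Type*} [Fintype S] [DecidableEq S] [Fintype T] [DecidableEq T]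
    [Fintype W] [DecidableEq W] : QStep S T W → ℕ
  | .fixed _ => 0
  | .useA => 1
  | .useAInv => 1
  | .useB => 1
  | .useBInv => 1

/-- A quantum algorithm with black-box access to two unknown unitaries (and their inverses) on the
spaces with bases `S` and `T`: a finite workspace, an initial basis state, a list of steps
(performed from first to last), and the real number that is output on each outcome of a final
measurement in the computational basis. The algorithm does not depend on the unknown unitaries. -/
structure QAlgorithm (S T : Type*) [Fintype S] [DecidableEq S] [Fintype T] [DecidableEq T] where
  W : Type
  [fintypeW : Fintype W]
  [decidableEqW : DecidableEq W]
  init : S × T × W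
  steps : List (QStep S T W)
  output : S × T × W → ℝ

attribute [instance] QAlgorithm.fintypeW QAlgorithm.decidableEqW

/-- The number of samples used by the algorithm: the total number of uses of the unknown unitaries
and their inverses. -/
def QAlgorithm.numSamples {S T : Type*} [Fintype S] [DecidableEq S] [Fintype T] [DecidableEq T]
    (𝒜 : QAlgorithm S T) : ℕ :=
  (𝒜.steps.map QStep.cost).sum

/-- The vector of amplitudes just before the final measurement. -/
noncomputable def QAlgorithm.finalState {S T : Type*} [Fintype S] [DecidableEq S] [Fintype T]
    [DecidableEq T] (𝒜 : QAlgorithm S T) (A : Matrix.unitaryGroup S ℂ)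
    (B : Matrix.unitaryGroup T ℂ) : S × T × 𝒜.W → ℂ :=
  𝒜.steps.foldl (fun v g => (g.op A B).mulVec v) (Pi.single 𝒜.init 1)

/-- The probability that the number output by the algorithm lies in `E`. -/
noncomputable def QAlgorithm.outputProb {S T : Type*} [Fintype S] [DecidableEq S] [Fintype T]
    [DecidableEq T] (𝒜 : QAlgorithm S T) (A : Matrix.unitaryGroup S ℂ)
    (B : Matrix.unitaryGroup T ℂ) (E : Set ℝ) : ℝ :=
  ∑ b, (𝒜.output ⁻¹' E).indicator (fun b => ‖𝒜.finalState A B b‖ ^ 2) b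

/-! Let r(x) = (p(x) + 1/n)/2. Since p and q have the same mass, ‖p-q‖ = Σ max(p-q, 0), and this is
the mean under r of g(√p(x), √q(x)), where g(a,b) = 2 max(a²-b², 0)/(a²+1/n) lies in [0,2]
(`sum_mul_trueGain`). The summand 1/n makes g Lipschitz with constant 2√n in the square roots
(`abs_gain_sub_gain_le`). Square roots of probabilities are what amplitude estimation delivers with
a precision that does not depend on x: O(m) uses give an error with fourth moment O(m⁻⁴)
(`RotatesBy.sum_pow_four_mul_nrmSq_branch_le`). The gain at level m thus has an error of fourth
moment O(n²/m⁴).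

Everything is done coherently. One circuit draws x from r and runs amplitude estimation for p(x) and
q(x) (`exists_sampling_circuit`). An outer amplitude estimation reads off the mean of a [0,1]-valued
function of the outcomes up to λ with O(1/λ) calls of the circuit (`estimatesWithin_jointMean`).

A single level m ~ √n/ε would cost √n/ε². Instead three levels √n/ε^{1/2}, √n/ε^{5/6}, √n/ε are
telescoped. The first mean is estimated directly, with 1/ε outer calls. Two consecutive levels are
read in the same experiment. Their difference is clipped to [-κ, κ] with κ = ε^{1/3} and then
ε^{1/2}, with bias O(ε) by the fourth moment, and κ/ε outer calls suffice. Each of the three terms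
costs √n/ε^{3/2} (`exists_estimatesWithin_tvDist_pow`).

This succeeds with probability 15/16; repetition brings in log(1/δ) (`EstimatesWithin.repeat`). The
factor log(1/ε) is not needed for small ε, but the claimed bound tends to 0 as ε → 1 or δ → 1. For ε
≥ 1/2 the constant 1/2 is output. For δ near 1 a coarse estimate with a random offset is good enough
(`EstimatesWithin.guess`). -/

/-! ### Block-diagonal, diagonal and permutation unitaries; state preparation. -/

section Slices

variable {Ω X R : Type*} [Fintype Ω] [DecidableEq Ω] [Fintype X] [DecidableEq X]
  [Fintype R] [DecidableEq R]

/-- The unitary on `Ω ≃ X × R` that applies `G r` to the first factor when the second one is `r`. -/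
noncomputable def slice (e : Ω ≃ X × R) :
    (R → Matrix.unitaryGroup X ℂ) →* Matrix.unitaryGroup Ω ℂ where
  toFun G := ⟨(Matrix.blockDiagonal fun r => (G r : Matrix X X ℂ)).submatrix e e, by
    rw [Matrix.mem_unitaryGroup_iff, Matrix.star_eq_conjTranspose, Matrix.conjTranspose_submatrix,
      Matrix.blockDiagonal_conjTranspose, Matrix.submatrix_mul_equiv, ← Matrix.blockDiagonal_mul]
    have h : (fun k => (G k : Matrix X X ℂ) * (G k : Matrix X X ℂ).conjTranspose) = 1 := by
      funext k
      rw [← Matrix.star_eq_conjTranspose]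
      exact Matrix.mem_unitaryGroup_iff.1 (G k).2
    rw [h, Matrix.blockDiagonal_one, Matrix.submatrix_one_equiv]⟩
  map_one' := by
    apply Subtype.ext
    have h : (fun r => ((1 : R → Matrix.unitaryGroup X ℂ) r : Matrix X X ℂ)) = 1 := rfl
    simp only [h, Matrix.blockDiagonal_one, Matrix.submatrix_one_equiv, OneMemClass.coe_one]
  map_mul' G H := by
    apply Subtype.ext
    simp [Matrix.submatrix_mul_equiv, Matrix.blockDiagonal_mul]

theorem slice_apply (e : Ω ≃ X × R) (G : R → Matrix.unitaryGroup X ℂ) (a b : Ω) :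
    (slice e G : Matrix Ω Ω ℂ) a b =
      if (e a).2 = (e b).2 then (G (e a).2 : Matrix X X ℂ) (e a).1 (e b).1 else 0 :=
  Matrix.blockDiagonal_apply (fun r => (G r : Matrix X X ℂ)) (e a) (e b)

theorem slice_mulVec (e : Ω ≃ X × R) (G : R → Matrix.unitaryGroup X ℂ) (v : Ω → ℂ) (a : Ω) :
    ((slice e G : Matrix Ω Ω ℂ).mulVec v) a =
      ((G (e a).2 : Matrix X X ℂ).mulVec fun x => v (e.symm (x, (e a).2))) (e a).1 := by
  simp only [Matrix.mulVec, dotProduct, slice_apply]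
  rw [← e.symm.sum_comp, Fintype.sum_prod_type]
  simp

open Classical in
/-- The diagonal unitary that changes the sign of the basis states in `P`. -/
noncomputable def signU (P : Ω → Prop) : Matrix.unitaryGroup Ω ℂ :=
  ⟨Matrix.diagonal fun a => if P a then -1 else 1, by
    rw [Matrix.mem_unitaryGroup_iff, Matrix.star_eq_conjTranspose, Matrix.diagonal_conjTranspose,
      Matrix.diagonal_mul_diagonal, ← Matrix.diagonal_one]
    congr 1
    funext a
    by_cases h : P a <;> simp [h]⟩

open Classical in
theorem signU_mulVec (P : Ω → Prop) (v : Ω → ℂ) (a : Ω) :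
    ((signU P : Matrix Ω Ω ℂ).mulVec v) a = (if P a then -1 else 1) * v a := by
  simp [signU, Matrix.mulVec_diagonal]

theorem signU_false : signU (fun _ : Ω => False) = 1 := by
  apply Subtype.ext; simp [signU]

/-- The unitary that permutes the basis states. -/
noncomputable def permU (σ : Equiv.Perm Ω) : Matrix.unitaryGroup Ω ℂ :=
  ⟨(1 : Matrix Ω Ω ℂ).submatrix σ (Equiv.refl Ω), by
    rw [Matrix.mem_unitaryGroup_iff, Matrix.star_eq_conjTranspose, Matrix.conjTranspose_submatrix,
      Matrix.submatrix_mul_equiv]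
    simp⟩

theorem permU_mulVec (σ : Equiv.Perm Ω) (v : Ω → ℂ) (a : Ω) :
    ((permU σ : Matrix Ω Ω ℂ).mulVec v) a = v (σ a) := by
  simp [permU, Matrix.mulVec, dotProduct, Matrix.one_apply]

/-- A unit vector extends to an orthonormal basis. This provides the fixed unitaries that prepare
superpositions. -/
theorem exists_unitary_col (v : Ω → ℂ) (hv : ∑ i, ‖v i‖ ^ 2 = 1) (i₀ : Ω) :
    ∃ U : Matrix.unitaryGroup Ω ℂ, ∀ i, (U : Matrix Ω Ω ℂ) i i₀ = v i := by
  have h1 : ‖(WithLp.toLp 2 v : EuclideanSpace ℂ Ω)‖ = 1 := by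
    rw [EuclideanSpace.norm_eq]; simp [hv]
  have h2 : Orthonormal ℂ (({i₀} : Set Ω).domRestrict fun _ => (WithLp.toLp 2 v : EuclideanSpace ℂ Ω)) := by
    constructor
    · intro i; exact h1
    · intro i j hij; exact absurd (Subsingleton.elim i j) hij
  obtain ⟨b, hb⟩ := h2.exists_orthonormalBasis_extension_of_card_eq (by simp)
  refine ⟨⟨(EuclideanSpace.basisFun Ω ℂ).toBasis.toMatrix b,
    (EuclideanSpace.basisFun Ω ℂ).toMatrix_orthonormalBasis_mem_unitary b⟩, fun i => ?_⟩
  simp [Module.Basis.toMatrix_apply, hb i₀ rfl]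

/-- The Grover iterate for the preparation `U`, starting from `x₀`, of the states in `good`. -/
noncomputable def grover (U : Matrix.unitaryGroup X ℂ) (x₀ : X) (good : X → Prop) :
    Matrix.unitaryGroup X ℂ :=
  U * signU (fun x => x ≠ x₀) * U⁻¹ * signU good

end Slices

/-! ### Circuits and their number of uses. -/

section Implementable

variable {S T W : Type*} [Fintype S] [DecidableEq S] [Fintype T] [DecidableEq T]
  [Fintype W] [DecidableEq W]

theorem QStep.op_mem (A : Matrix.unitaryGroup S ℂ) (B : Matrix.unitaryGroup T ℂ)
    (g : QStep S T W) : g.op A B ∈ Matrix.unitaryGroup (S × T × W) ℂ := by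
  cases g with
  | fixed U => exact U.2
  | useA => exact Matrix.kronecker_mem_unitary A.2 (one_mem _)
  | useAInv => exact Matrix.kronecker_mem_unitary (A⁻¹).2 (one_mem _)
  | useB =>
    exact Matrix.kronecker_mem_unitary (one_mem _) (Matrix.kronecker_mem_unitary B.2 (one_mem _))
  | useBInv =>
    exact Matrix.kronecker_mem_unitary (one_mem _)
      (Matrix.kronecker_mem_unitary (B⁻¹).2 (one_mem _))

/-- The operator performed by a step, as an element of the unitary group. -/
noncomputable def QStep.opU (A : Matrix.unitaryGroup S ℂ) (B : Matrix.unitaryGroup T ℂ)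
    (g : QStep S T W) : Matrix.unitaryGroup (S × T × W) ℂ := ⟨g.op A B, g.op_mem A B⟩

/-- The inverse of a step. -/
noncomputable def QStep.inv : QStep S T W → QStep S T W
  | .fixed U => .fixed U⁻¹
  | .useA => .useAInv
  | .useAInv => .useA
  | .useB => .useBInv
  | .useBInv => .useB

theorem QStep.cost_inv (g : QStep S T W) : g.inv.cost = g.cost := by cases g <;> rfl

theorem QStep.opU_inv (A : Matrix.unitaryGroup S ℂ) (B : Matrix.unitaryGroup T ℂ)
    (g : QStep S T W) : g.inv.opU A B = (g.opU A B)⁻¹ := by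
  apply Subtype.ext
  cases g <;>
    simp [QStep.inv, QStep.opU, QStep.op, Matrix.star_eq_conjTranspose,
      Matrix.conjTranspose_kronecker]

/-- A family of unitaries, depending on the unknown unitaries, that can be performed with `k` uses
of the latter. -/
def Implementable (k : ℕ) (F : Matrix.unitaryGroup S ℂ → Matrix.unitaryGroup T ℂ →
    Matrix.unitaryGroup (S × T × W) ℂ) : Prop :=
  ∃ l : List (QStep S T W), (l.map QStep.cost).sum = k ∧
    ∀ A B, F A B = (l.map (QStep.opU A B)).reverse.prod

theorem Implementable.fixed (U : Matrix.unitaryGroup (S × T × W) ℂ) :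
    Implementable 0 fun _ _ => U :=
  ⟨[.fixed U], by simp [QStep.cost], fun A B => by simp [QStep.opU, QStep.op]⟩

variable {F G : Matrix.unitaryGroup S ℂ → Matrix.unitaryGroup T ℂ →
    Matrix.unitaryGroup (S × T × W) ℂ} {k k' : ℕ}

theorem Implementable.mul (hF : Implementable k F) (hG : Implementable k' G) :
    Implementable (k + k') fun A B => F A B * G A B := by
  obtain ⟨l, hl, h⟩ := hF
  obtain ⟨l', hl', h'⟩ := hG
  refine ⟨l' ++ l, by simp [hl, hl', add_comm], fun A B => ?_⟩
  simp only [h, h']; simp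

theorem Implementable.inv (hF : Implementable k F) : Implementable k fun A B => (F A B)⁻¹ := by
  obtain ⟨l, hl, h⟩ := hF
  refine ⟨(l.map QStep.inv).reverse, ?_, fun A B => ?_⟩
  · rw [List.map_reverse, List.sum_reverse, List.map_map]
    simpa [Function.comp_def, QStep.cost_inv] using hl
  · simp only [h]
    rw [List.prod_inv_reverse]
    simp [Function.comp_def, QStep.opU_inv]

theorem Implementable.congr (hF : Implementable k F) (h : ∀ A B, F A B = G A B) :
    Implementable k G := by
  have : F = G := by funext A B; exact h A B
  exact this ▸ hF

/-- Sorting the registers so that the second unknown unitary acts on the first one. -/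
def secondEquiv (S T W : Type*) : S × T × W ≃ T × (S × W) where
  toFun a := (a.2.1, a.1, a.2.2)
  invFun a := (a.2.1, a.1, a.2.2)
  left_inv _ := rfl
  right_inv _ := rfl

theorem implementable_A : Implementable (W := W) 1 fun (A : Matrix.unitaryGroup S ℂ)
    (_ : Matrix.unitaryGroup T ℂ) => slice (Equiv.refl (S × (T × W))) fun _ => A := by
  refine ⟨[.useA], by simp [QStep.cost], fun A B => ?_⟩
  apply Matrix.UnitaryGroup.ext
  intro a b
  rw [slice_apply]
  by_cases h : a.2 = b.2 <;>
    simp [QStep.opU, QStep.op, Matrix.kroneckerMap_apply, Matrix.one_apply, h]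

theorem implementable_B : Implementable (W := W) 1 fun (_ : Matrix.unitaryGroup S ℂ)
    (B : Matrix.unitaryGroup T ℂ) => slice (secondEquiv S T W) fun _ => B := by
  refine ⟨[.useB], by simp [QStep.cost], fun A B => ?_⟩
  apply Matrix.UnitaryGroup.ext
  rintro ⟨a1, a2, a3⟩ ⟨b1, b2, b3⟩
  rw [slice_apply]
  by_cases h : a1 = b1 <;> by_cases h' : a3 = b3 <;>
    simp [QStep.opU, QStep.op, Matrix.kroneckerMap_apply, secondEquiv, h, h']

/-- Only the two reflections need to be controlled: when they are switched off, `U` and `U⁻¹`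
cancel. So no controlled use of the unknown unitaries is required, and each of the `N` rounds costs
`2 * k`. -/
theorem Implementable.controlled_grover_pow {X R : Type*} [Fintype X] [DecidableEq X] [Fintype R]
    [DecidableEq R] (e : S × T × W ≃ X × R)
    {U : Matrix.unitaryGroup S ℂ → Matrix.unitaryGroup T ℂ → Matrix.unitaryGroup X ℂ}
    (hU : Implementable k fun A B => slice e fun _ => U A B) (x₀ : X) (good : R → X → Prop)
    (clock : R → ℕ) (N : ℕ) (hN : ∀ r, clock r ≤ N) :
    Implementable (2 * k * N) fun A B =>
      slice e fun r => grover (U A B) x₀ (good r) ^ clock r := by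
  -- Truncating the exponent at `N` makes the induction work: round `N` is active exactly where `N <
  -- clock r`.
  have key : ∀ N, Implementable (2 * k * N) fun A B =>
      slice e fun r => grover (U A B) x₀ (good r) ^ min (clock r) N := by
    intro N
    induction N with
    | zero =>
      refine (Implementable.fixed 1).congr fun A B => ?_
      simp only [Nat.min_zero, pow_zero]
      exact (map_one (slice e)).symm
    | succ N ih =>
      have h1 := (((hU.mul (.fixed (slice e fun r => signU fun x => N < clock r ∧ x ≠ x₀))).mul
        hU.inv).mul (.fixed (slice e fun r => signU fun x => N < clock r ∧ good r x))).mul ih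
      have h2 : k + 0 + k + 0 + 2 * k * N = 2 * k * (N + 1) := by ring
      rw [h2] at h1
      refine h1.congr fun A B => ?_
      rw [← map_inv, ← map_mul, ← map_mul, ← map_mul, ← map_mul]
      congr 1
      funext r
      simp only [Pi.mul_apply, Pi.inv_apply]
      by_cases h : N < clock r
      · rw [min_eq_right h.le, min_eq_right (Nat.succ_le_of_lt h), pow_succ']
        simp [h, grover]
      · rw [min_eq_left (by omega), min_eq_left (by omega)]
        simp [h, signU_false]
  refine (key N).congr fun A B => ?_
  simp [min_eq_left (hN _)]

variable (S T) in
/-- Separating a part of the workspace. -/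
def splitEquiv {W' C : Type*} (w : W' ≃ W × C) : S × T × W' ≃ (S × T × W) × C where
  toFun a := ((a.1, a.2.1, (w a.2.2).1), (w a.2.2).2)
  invFun a := (a.1.1, a.1.2.1, w.symm (a.1.2.2, a.2))
  left_inv a := by simp
  right_inv a := by simp

/-- The same circuit next to an idle register `C`; this lets circuits with different workspaces be
composed. -/
theorem Implementable.lift {W' C : Type*} [Fintype W'] [DecidableEq W'] [Fintype C] [DecidableEq C]
    (hF : Implementable k F) (w : W' ≃ W × C) :
    Implementable k fun A B => slice (splitEquiv S T w) fun _ => F A B := by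
  obtain ⟨l, hl, h⟩ := hF
  let f : QStep S T W → QStep S T W' := fun g => match g with
    | .fixed U => .fixed (slice (splitEquiv S T w) fun _ => U)
    | .useA => .useA
    | .useAInv => .useAInv
    | .useB => .useB
    | .useBInv => .useBInv
  have hf1 : ∀ g, (f g).cost = g.cost := by intro g; cases g <;> rfl
  have hf2 : ∀ g A B, (f g).opU A B = slice (splitEquiv S T w) fun _ => g.opU A B := by
    intro g A B
    apply Matrix.UnitaryGroup.ext
    rintro ⟨a1, a2, a3⟩ ⟨b1, b2, b3⟩
    rw [slice_apply]
    have hw : a3 = b3 ↔ (w a3).1 = (w b3).1 ∧ (w a3).2 = (w b3).2 := by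
      rw [← w.injective.eq_iff, Prod.ext_iff]
    cases g with
    | fixed U => simp [f, QStep.opU, QStep.op, slice_apply]
    | _ =>
      by_cases h4 : (w a3).2 = (w b3).2 <;>
      simp [f, QStep.opU, QStep.op, Matrix.kroneckerMap_apply, Matrix.one_apply, splitEquiv, h4,
        hw]
  refine ⟨l.map f, by simpa [Function.comp_def, hf1] using hl, fun A B => ?_⟩
  have : ∀ l : List (QStep S T W), (slice (splitEquiv S T w) fun _ =>
      (l.map (QStep.opU A B)).reverse.prod) = ((l.map f).map (QStep.opU A B)).reverse.prod := by
    intro l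
    induction l with
    | nil => exact map_one _
    | cons g l ih =>
      simp only [List.map_cons, List.reverse_cons, List.prod_append, List.prod_cons, List.prod_nil,
        mul_one]
      rw [← ih, hf2, ← map_mul]
      rfl
  simp only [h, this]

end Implementable

/-! ### Squared norms and Parseval. -/

section NormSq

variable {X : Type*} [Fintype X]

/-- The squared Euclidean norm of a vector of amplitudes. -/
noncomputable def nrmSq (v : X → ℂ) : ℝ := ∑ i, ‖v i‖ ^ 2

theorem nrmSq_nonneg (v : X → ℂ) : 0 ≤ nrmSq v := Finset.sum_nonneg fun _ _ => by positivity

theorem nrmSq_eq (v : X → ℂ) : nrmSq v = ‖(WithLp.toLp 2 v : EuclideanSpace ℂ X)‖ ^ 2 := by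
  rw [EuclideanSpace.norm_sq_eq]; rfl

theorem nrmSq_smul (c : ℂ) (v : X → ℂ) : nrmSq (c • v) = ‖c‖ ^ 2 * nrmSq v := by
  simp [nrmSq, Finset.mul_sum, mul_pow]

theorem ofReal_nrmSq (v : X → ℂ) : (nrmSq v : ℂ) = star v ⬝ᵥ v := by
  simp only [nrmSq, dotProduct, Complex.ofReal_sum, Pi.star_apply]
  refine Finset.sum_congr rfl fun i _ => ?_
  rw [RCLike.star_def, ← Complex.normSq_eq_conj_mul_self, Complex.normSq_eq_norm_sq]

theorem nrmSq_unitary [DecidableEq X] (U : Matrix.unitaryGroup X ℂ) (v : X → ℂ) :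
    nrmSq ((U : Matrix X X ℂ).mulVec v) = nrmSq v := by
  apply Complex.ofReal_injective
  rw [ofReal_nrmSq, ofReal_nrmSq, Matrix.star_mulVec, Matrix.dotProduct_mulVec, Matrix.vecMul_vecMul,
    ← Matrix.star_eq_conjTranspose, Matrix.UnitaryGroup.star_mul_self, Matrix.vecMul_one]

/-- Parseval, applied to each coordinate of `X` separately. -/
theorem sum_nrmSq_fourier {C : Type*} [Fintype C] [DecidableEq C]
    (F : Matrix.unitaryGroup C ℂ) (h : C → X → ℂ) :
    ∑ y, nrmSq (∑ t, (F : Matrix C C ℂ) y t • h t) = ∑ t, nrmSq (h t) := by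
  simp only [nrmSq]
  rw [Finset.sum_comm, Finset.sum_comm (s := (Finset.univ : Finset C))]
  refine Finset.sum_congr rfl fun i _ => ?_
  have := nrmSq_unitary F fun t => h t i
  simpa [nrmSq, Matrix.mulVec, dotProduct] using this

/-- A unitary as an isometry of the Euclidean space. -/
noncomputable def unitaryIsometry [DecidableEq X] (U : Matrix.unitaryGroup X ℂ) :
    EuclideanSpace ℂ X →ₗᵢ[ℂ] EuclideanSpace ℂ X where
  toFun v := WithLp.toLp 2 ((U : Matrix X X ℂ).mulVec v.ofLp)
  map_add' v w := by simp [Matrix.mulVec_add]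
  map_smul' c v := by simp [Matrix.mulVec_smul]
  norm_map' v := by
    have := nrmSq_unitary U v.ofLp
    rw [nrmSq_eq, nrmSq_eq] at this
    simpa using this

end NormSq

/-! ### A spectral gap estimate on the plane of a rotation. -/

section Gap

open ComplexConjugate

variable {E : Type*} [NormedAddCommGroup E] [InnerProductSpace ℂ E]

/-- Applying `Q` to both arguments preserves the inner product but multiplies it by `conj lam ^ 2`,
which is not 1. -/
theorem LinearIsometry.inner_eq_zero_of_eigenvectors (Q : E →ₗᵢ[ℂ] E) {lam : ℂ} (hlam : ‖lam‖ = 1)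
    (hne : lam ≠ conj lam) {b c : E} (hb : Q b = lam • b) (hc : Q c = conj lam • c) :
    inner ℂ b c = 0 := by
  have h : inner ℂ b c = conj lam * conj lam * inner ℂ b c := by
    conv_lhs => rw [← Q.inner_map_map, hb, hc, inner_smul_left, inner_smul_right]
    ring
  by_contra h0
  have h1 : conj lam * conj lam = 1 := mul_right_cancel₀ h0 (by rw [one_mul]; exact h.symm)
  have h2 : lam * conj lam = 1 := by
    rw [Complex.mul_conj, Complex.normSq_eq_norm_sq, hlam]; simp
  have h3 : conj lam ≠ 0 := by intro h; rw [h] at h2; simp at h2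
  exact hne (mul_right_cancel₀ h3 (h2.trans h1.symm))

/-- The quadratic relation splits `a` into eigenvectors for `lam` and `conj lam`. They are
orthogonal, so Pythagoras bounds `Q - z` below by the distance of `z` from the spectrum. -/
theorem LinearIsometry.mul_norm_le_norm_sub_smul (Q : E →ₗᵢ[ℂ] E) {lam z : ℂ} (hlam : ‖lam‖ = 1)
    {a : E} (ha : Q (Q a) = (lam + conj lam) • Q a - a) {d : ℝ} (hd : 0 ≤ d)
    (h1 : d ≤ ‖lam - z‖) (h2 : d ≤ ‖conj lam - z‖) : d * ‖a‖ ≤ ‖Q a - z • a‖ := by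
  have hll : lam * conj lam = 1 := by
    rw [Complex.mul_conj, Complex.normSq_eq_norm_sq, hlam]; simp
  have hb : Q (Q a - conj lam • a) = lam • (Q a - conj lam • a) := by
    rw [map_sub, map_smul, ha, smul_sub, smul_smul, hll]; module
  have hc : Q (Q a - lam • a) = conj lam • (Q a - lam • a) := by
    rw [map_sub, map_smul, ha, smul_sub, smul_smul, mul_comm, hll]; module
  -- If `lam = ±1` the relation only says `(Q - lam)² a = 0`, but an isometry has no Jordan blocks,
  -- so `Q a = lam • a`. Otherwise `b` and `c` are eigenvectors and `(lam - conj lam) • a = b - c`.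
  by_cases hne : lam = conj lam
  · have h0 : Q a - lam • a = 0 := by
      rw [← inner_self_eq_zero (𝕜 := ℂ)]
      rw [← hne] at hc hll
      have h3 : lam • inner ℂ (Q a - lam • a) (Q a) = inner ℂ (Q a - lam • a) a := by
        rw [← Q.inner_map_map _ a, hc, inner_smul_left, ← hne, smul_eq_mul]
      conv_lhs => rw [inner_sub_right (Q a - lam • a), inner_smul_right, ← h3, smul_eq_mul,
        ← mul_assoc, hll]
      ring
    have h4 : Q a - z • a = (lam - z) • a := by rw [sub_smul, ← sub_eq_zero.1 h0]
    rw [h4, norm_smul]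
    gcongr
  · set b := Q a - conj lam • a
    set c := Q a - lam • a
    have hbc := Q.inner_eq_zero_of_eigenvectors hlam hne hb hc
    have h5 : (lam - conj lam) • a = b - c := by simp only [b, c]; module
    have h6 : (lam - conj lam) • (Q a - z • a) = (lam - z) • b - (conj lam - z) • c := by
      simp only [b, c]; module
    have pyth : ∀ s t : ℂ, ‖s • b - t • c‖ ^ 2 = ‖s‖ ^ 2 * ‖b‖ ^ 2 + ‖t‖ ^ 2 * ‖c‖ ^ 2 := by
      intro s t
      rw [norm_sub_sq (𝕜 := ℂ), inner_smul_left, inner_smul_right, hbc]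
      simp [norm_smul, mul_pow]
    have h7 : ‖lam - conj lam‖ ^ 2 * ‖a‖ ^ 2 = ‖b‖ ^ 2 + ‖c‖ ^ 2 := by
      rw [← mul_pow, ← norm_smul, h5]
      simpa using pyth 1 1
    have h8 : ‖lam - conj lam‖ ^ 2 * ‖Q a - z • a‖ ^ 2 =
        ‖lam - z‖ ^ 2 * ‖b‖ ^ 2 + ‖conj lam - z‖ ^ 2 * ‖c‖ ^ 2 := by
      rw [← mul_pow, ← norm_smul, h6, pyth]
    have h9 : 0 < ‖lam - conj lam‖ ^ 2 := by
      have := norm_pos_iff.2 (sub_ne_zero.2 hne); positivity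
    have h10 : d ^ 2 ≤ ‖lam - z‖ ^ 2 := by gcongr
    have h11 : d ^ 2 ≤ ‖conj lam - z‖ ^ 2 := by gcongr
    apply le_of_sq_le_sq _ (norm_nonneg _)
    rw [mul_pow]
    refine le_of_mul_le_mul_left ?_ h9
    rw [h8]
    calc ‖lam - conj lam‖ ^ 2 * (d ^ 2 * ‖a‖ ^ 2) = d ^ 2 * (‖lam - conj lam‖ ^ 2 * ‖a‖ ^ 2) := by
          ring
      _ = d ^ 2 * ‖b‖ ^ 2 + d ^ 2 * ‖c‖ ^ 2 := by rw [h7]; ring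
      _ ≤ _ := by gcongr

end Gap

/-! ### Phase estimation with a general window. -/

section Clocks

/-- A register for phase estimation: in state `t` the unitary is applied `time t` times; `window`
is the initial state and `fourier` the final transformation. -/
structure Clock (C : Type*) [Fintype C] [DecidableEq C] where
  time : C → ℕ
  fourier : Matrix.unitaryGroup C ℂ
  window : C → ℂ
  sum_window : ∑ t, ‖window t‖ ^ 2 = 1

variable {C C' X : Type*} [Fintype C] [DecidableEq C] [Fintype C'] [DecidableEq C'] [Fintype X]
  [DecidableEq X]

/-- The (unnormalised) state after phase estimation of `Q` on `v` with outcome `y`. -/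
noncomputable def Clock.branch (κ : Clock C) (Q : Matrix.unitaryGroup X ℂ) (v : X → ℂ) (y : C) :
    X → ℂ :=
  ∑ t, ((κ.fourier : Matrix C C ℂ) y t * κ.window t) •
    ((Q ^ κ.time t : Matrix.unitaryGroup X ℂ) : Matrix X X ℂ).mulVec v

theorem Clock.sum_nrmSq_branch (κ : Clock C) (Q : Matrix.unitaryGroup X ℂ) (v : X → ℂ) :
    ∑ y, nrmSq (κ.branch Q v y) = nrmSq v := by
  simp only [Clock.branch, mul_smul]
  rw [sum_nrmSq_fourier]
  simp only [nrmSq_smul, nrmSq_unitary]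
  rw [← Finset.sum_mul, κ.sum_window, one_mul]

/-- Two clocks, to be used one after the other. -/
noncomputable def Clock.prod (κ : Clock C) (κ' : Clock C') : Clock (C × C') where
  time t := κ.time t.1 + κ'.time t.2
  fourier := ⟨(κ.fourier : Matrix C C ℂ) ⊗ₖ (κ'.fourier : Matrix C' C' ℂ),
    Matrix.kronecker_mem_unitary κ.fourier.2 κ'.fourier.2⟩
  window t := κ.window t.1 * κ'.window t.2
  sum_window := by
    simp only [norm_mul, mul_pow]
    rw [Fintype.sum_prod_type]
    simp only [← Finset.mul_sum, κ'.sum_window, mul_one, κ.sum_window]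

theorem Clock.prod_branch (κ : Clock C) (κ' : Clock C') (Q : Matrix.unitaryGroup X ℂ) (v : X → ℂ)
    (y : C × C') : (κ.prod κ').branch Q v y = κ.branch Q (κ'.branch Q v y.2) y.1 := by
  simp only [Clock.branch, Clock.prod, Matrix.kroneckerMap_apply]
  rw [Fintype.sum_prod_type]
  refine Finset.sum_congr rfl fun t _ => ?_
  simp only [Matrix.mulVec_sum, Finset.smul_sum, Matrix.mulVec_smul, smul_smul, Matrix.mulVec_mulVec,
    pow_add, Matrix.UnitaryGroup.mul_val]
  refine Finset.sum_congr rfl fun t' _ => ?_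
  congr 1
  ring

/-- The times of the two clocks add and all powers of `Q` commute, so either clock may be taken to
act first. This gives the marginal of each clock in a combined experiment. -/
theorem Clock.prod_branch' (κ : Clock C) (κ' : Clock C') (Q : Matrix.unitaryGroup X ℂ) (v : X → ℂ)
    (y : C × C') : (κ.prod κ').branch Q v y = κ'.branch Q (κ.branch Q v y.1) y.2 := by
  rw [← Clock.prod_branch κ' κ Q v (y.2, y.1)]
  simp only [Clock.branch, Clock.prod, Matrix.kroneckerMap_apply]
  rw [← (Equiv.prodComm C C').sum_comp]
  refine Finset.sum_congr rfl fun t _ => ?_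
  simp only [Equiv.prodComm_apply, Prod.fst_swap, Prod.snd_swap]
  rw [add_comm]
  congr 1
  ring

end Clocks

/-! ### The discrete Fourier transform on the clock. -/

section Fourier

open ComplexConjugate

/-- The `M`-th root of unity with index `y`. -/
noncomputable def clockRoot (M : ℕ) (y : Fin M) : ℂ :=
  Complex.exp (2 * Real.pi * Complex.I / M) ^ (y : ℕ)

theorem norm_clockRoot {M : ℕ} (y : Fin M) : ‖clockRoot M y‖ = 1 := by
  have hM : M ≠ 0 := by have := y.2; omega
  rw [clockRoot, norm_pow, (Complex.isPrimitiveRoot_exp M hM).norm'_eq_one hM, one_pow]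

theorem clockRoot_pow {M : ℕ} (y : Fin M) : clockRoot M y ^ M = 1 := by
  have hM : M ≠ 0 := by have := y.2; omega
  rw [clockRoot, pow_right_comm, (Complex.isPrimitiveRoot_exp M hM).pow_eq_one, one_pow]

theorem clockRoot_injective (M : ℕ) : Function.Injective (clockRoot M) := by
  intro y y' h
  have hM : M ≠ 0 := by have := y.2; omega
  exact Fin.ext ((Complex.isPrimitiveRoot_exp M hM).pow_inj y.2 y'.2 h)

theorem conj_mul_self_of_norm_eq_one {z : ℂ} (hz : ‖z‖ = 1) : conj z * z = 1 := by
  rw [← Complex.normSq_eq_conj_mul_self, Complex.normSq_eq_norm_sq, hz]; simp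

/-- The inverse discrete Fourier transform. -/
noncomputable def fourierU (M : ℕ) : Matrix.unitaryGroup (Fin M) ℂ :=
  ⟨Matrix.of fun y t => ((√(M : ℝ))⁻¹ : ℝ) * conj (clockRoot M y) ^ (t : ℕ), by
    rw [Matrix.mem_unitaryGroup_iff]
    ext y y'
    have hM : (0 : ℝ) < M := by exact_mod_cast y.pos
    have hs : ((√(M : ℝ))⁻¹ : ℝ) * (√(M : ℝ))⁻¹ = (M : ℝ)⁻¹ := by
      rw [← mul_inv, Real.mul_self_sqrt hM.le]
    have h1 : ∀ t : Fin M, ((√(M : ℝ))⁻¹ : ℝ) * conj (clockRoot M y) ^ (t : ℕ) *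
        conj (((√(M : ℝ))⁻¹ : ℝ) * conj (clockRoot M y') ^ (t : ℕ)) =
        ((M : ℝ)⁻¹ : ℝ) * (conj (clockRoot M y) * clockRoot M y') ^ (t : ℕ) := by
      intro t
      rw [← hs]
      simp only [map_mul, map_pow, Complex.conj_conj, Complex.conj_ofReal, Complex.ofReal_mul]
      ring
    simp only [Matrix.mul_apply, Matrix.star_apply, Matrix.of_apply, RCLike.star_def, h1]
    rw [← Finset.mul_sum, Fin.sum_univ_eq_sum_range
      (fun t => (conj (clockRoot M y) * clockRoot M y') ^ t)]
    by_cases h : y = y'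
    · subst h
      simp only [conj_mul_self_of_norm_eq_one (norm_clockRoot y), one_pow, Finset.sum_const,
        Finset.card_range, Matrix.one_apply_eq, nsmul_eq_mul, mul_one]
      rw [Complex.ofReal_inv, Complex.ofReal_natCast, inv_mul_cancel₀]
      exact_mod_cast hM.ne'
    · have hr : conj (clockRoot M y) * clockRoot M y' ≠ 1 := by
        intro hr
        have h2 : clockRoot M y' = clockRoot M y := by
          calc clockRoot M y' = (conj (clockRoot M y) * clockRoot M y) * clockRoot M y' := by
                rw [conj_mul_self_of_norm_eq_one (norm_clockRoot y), one_mul]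
            _ = (conj (clockRoot M y) * clockRoot M y') * clockRoot M y := by ring
            _ = clockRoot M y := by rw [hr, one_mul]
        exact h (clockRoot_injective M h2).symm
      rw [geom_sum_eq hr, mul_pow, clockRoot_pow, ← map_pow, clockRoot_pow]
      simp [Matrix.one_apply_ne h]⟩

theorem fourierU_apply (M : ℕ) (y t : Fin M) : (fourierU M : Matrix (Fin M) (Fin M) ℂ) y t =
    ((√(M : ℝ))⁻¹ : ℝ) * conj (clockRoot M y) ^ (t : ℕ) := rfl

end Fourier

/-! ### A window with small second differences. -/

section Window

/-- Backward difference of a sequence, continued by zero. -/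
def backDiff (c : ℕ → ℝ) (t : ℕ) : ℝ := c t - if t = 0 then 0 else c (t - 1)

theorem backDiff_smul (a : ℝ) (c : ℕ → ℝ) (t : ℕ) :
    backDiff (fun t => a * c t) t = a * backDiff c t := by
  unfold backDiff
  split_ifs <;> ring

/-- A bump on `{0, …, 4 m - 1}`. -/
def bump (m t : ℕ) : ℝ := (((t + 1) * (4 * m - t) : ℕ) : ℝ) ^ 2

theorem bump_eq {m t : ℕ} (h : t ≤ 4 * m) : bump m t = ((t + 1) * (4 * m - t : ℝ)) ^ 2 := by
  rw [bump, Nat.cast_mul, Nat.cast_sub h]; push_cast; ring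

theorem bump_eq_zero {m t : ℕ} (h : 4 * m ≤ t) : bump m t = 0 := by
  rw [bump, Nat.sub_eq_zero_of_le h]; simp

/-- The bump is the square of a quadratic with zeros at -1 and `4 m`. These zeros are double, so
continuation by zero keeps the second difference O(m²) at both ends, although the bump has height of
order m⁴. -/
theorem abs_backDiff_backDiff_bump_le {m t : ℕ} (hm : 0 < m) (ht : t < 4 * m + 2) :
    |backDiff (backDiff (bump m)) t| ≤ 2 * (4 * m + 1 : ℝ) ^ 2 := by
  have hm' : (1 : ℝ) ≤ m := by exact_mod_cast hm
  rcases Nat.eq_zero_or_pos t with rfl | h0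
  · simp only [backDiff, if_true, sub_zero]
    rw [bump_eq (by omega), abs_of_nonneg (by positivity)]
    push_cast
    nlinarith
  obtain ⟨s, rfl⟩ : ∃ s, t = s + 1 := ⟨t - 1, by omega⟩
  have hprev : backDiff (backDiff (bump m)) (s + 1) =
      bump m (s + 1) - 2 * bump m s + if s = 0 then 0 else bump m (s - 1) := by
    simp only [backDiff, Nat.add_one_ne_zero, if_false, Nat.add_sub_cancel]
    ring
  rw [hprev]
  rcases Nat.lt_or_ge s (4 * m) with hs | hs
  · have h2 : (if s = 0 then 0 else bump m (s - 1)) = ((s : ℝ) * (4 * m - s + 1)) ^ 2 := by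
      split_ifs with h
      · simp [h]
      · rw [bump_eq (by omega), Nat.cast_sub (by omega)]; push_cast; ring
    have hs' : (s : ℝ) + 1 ≤ 4 * m := by exact_mod_cast hs
    have hs0 : (0 : ℝ) ≤ s := Nat.cast_nonneg s
    rw [h2, bump_eq (by omega), bump_eq (by omega)]
    push_cast
    have h3 : (((s : ℝ) + 1 + 1) * (4 * m - (s + 1))) ^ 2 - 2 * ((s + 1) * (4 * m - s)) ^ 2 +
        (s * (4 * m - s + 1)) ^ 2 = (4 * m - 2 * s - 2) ^ 2 + (2 * s - 4 * m) ^ 2 -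
        4 * ((s + 1) * (4 * m - s)) := by ring
    rw [h3, abs_le]
    have h4 : 0 ≤ ((s : ℝ) + 1) * (4 * m - s) := mul_nonneg (by linarith) (by linarith)
    have h5 : (4 * m - 2 * s - 2 : ℝ) ^ 2 ≤ (4 * m) ^ 2 :=
      sq_le_sq' (by linarith) (by linarith)
    have h6 : (2 * s - 4 * m : ℝ) ^ 2 ≤ (4 * m) ^ 2 := sq_le_sq' (by linarith) (by linarith)
    constructor
    · nlinarith [sq_nonneg ((s : ℝ) + 1 - (4 * m - s)), sq_nonneg (4 * m - 2 * s - 2 : ℝ),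
        sq_nonneg (2 * s - 4 * m : ℝ), sq_nonneg (4 * m + 1 : ℝ)]
    · nlinarith
  -- At the last index only the value of the bump at `4 m - 1` survives.
  · obtain rfl : s = 4 * m := by omega
    rw [bump_eq_zero (by omega), bump_eq_zero le_rfl, if_neg (by omega), bump_eq (by omega),
      Nat.cast_sub (by omega)]
    push_cast
    rw [abs_of_nonneg (by positivity)]
    nlinarith

/-- Each of the `2 m` indices in `[m, 3 m)` contributes at least m⁸. -/
theorem le_sum_bump_sq (m : ℕ) :
    2 * (m : ℝ) ^ 9 ≤ ∑ t ∈ Finset.range (4 * m + 2), bump m t ^ 2 := by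
  calc 2 * (m : ℝ) ^ 9 = ∑ _t ∈ Finset.Ico m (3 * m), (m : ℝ) ^ 8 := by
        rw [Finset.sum_const, Nat.card_Ico, nsmul_eq_mul, show 3 * m - m = 2 * m by omega]
        push_cast; ring
    _ ≤ ∑ t ∈ Finset.Ico m (3 * m), bump m t ^ 2 := by
        refine Finset.sum_le_sum fun t ht => ?_
        rw [Finset.mem_Ico] at ht
        have h : m * m ≤ (t + 1) * (4 * m - t) := Nat.mul_le_mul (by omega) (by omega)
        have h' : (m : ℝ) * m ≤ (((t + 1) * (4 * m - t) : ℕ) : ℝ) := by exact_mod_cast h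
        calc (m : ℝ) ^ 8 = ((m * m : ℝ) ^ 2) ^ 2 := by ring
          _ ≤ _ := by unfold bump; gcongr
    _ ≤ _ := by
        refine Finset.sum_le_sum_of_subset_of_nonneg (fun t ht => ?_) fun _ _ _ => by positivity
        rw [Finset.mem_Ico] at ht
        exact Finset.mem_range.2 (by omega)

/-- The second differences have squared norm O(m⁵), the bump at least 2m⁹. The constant has room: 16
is the 2⁴ from the halving in `rootEst`, and 2187 is chosen with 4⁴ · 2187 = 72⁴/48 in view, the
form in which it enters the failure probability. -/
theorem sum_backDiff_backDiff_bump_le {m : ℕ} (hm : 0 < m) :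
    ∑ t ∈ Finset.range (4 * m + 2), backDiff (backDiff (bump m)) t ^ 2 ≤
      16 * 2187 / (m : ℝ) ^ 4 * ∑ t ∈ Finset.range (4 * m + 2), bump m t ^ 2 := by
  have hm' : (1 : ℝ) ≤ m := by exact_mod_cast hm
  calc ∑ t ∈ Finset.range (4 * m + 2), backDiff (backDiff (bump m)) t ^ 2
      ≤ ∑ t ∈ Finset.range (4 * m + 2), (2 * (4 * m + 1 : ℝ) ^ 2) ^ 2 := by
        refine Finset.sum_le_sum fun t ht => ?_
        rw [← sq_abs]
        have := abs_backDiff_backDiff_bump_le hm (Finset.mem_range.1 ht)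
        gcongr
    _ ≤ ∑ t ∈ Finset.range (4 * m + 2), (2 * (5 * m : ℝ) ^ 2) ^ 2 := by
        gcongr; linarith
    _ ≤ (6 * m) * (2 * (5 * m : ℝ) ^ 2) ^ 2 := by
        rw [Finset.sum_const, Finset.card_range, nsmul_eq_mul]
        gcongr
        push_cast; linarith
    _ = 15000 * (m : ℝ) ^ 5 := by ring
    _ ≤ 16 * 2187 / (m : ℝ) ^ 4 * (2 * (m : ℝ) ^ 9) := by
        have : 16 * 2187 / (m : ℝ) ^ 4 * (2 * (m : ℝ) ^ 9) = 69984 * (m : ℝ) ^ 5 := by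
          field_simp; norm_num
        rw [this]; gcongr; norm_num
    _ ≤ _ := by gcongr; exact le_sum_bump_sq m

end Window

/-! ### Fourth moment of the error of phase estimation. -/

section PhaseClock

open ComplexConjugate

/-- The phase estimation clock of size `4 m + 2`. -/
noncomputable def phaseClock (m : ℕ) (hm : 0 < m) : Clock (Fin (4 * m + 2)) where
  time t := t
  fourier := fourierU _
  window t := ((√(∑ t ∈ Finset.range (4 * m + 2), bump m t ^ 2))⁻¹ * bump m t : ℝ)
  sum_window := by
    have h := le_sum_bump_sq m
    have hm' : (0 : ℝ) < m := by exact_mod_cast hm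
    have h0 : 0 < ∑ t ∈ Finset.range (4 * m + 2), bump m t ^ 2 := lt_of_lt_of_le (by positivity) h
    simp only [Complex.norm_real, Real.norm_eq_abs, sq_abs, mul_pow]
    rw [← Finset.mul_sum, Fin.sum_univ_eq_sum_range (fun t => bump m t ^ 2), inv_pow,
      Real.sq_sqrt h0.le, inv_mul_cancel₀ h0.ne']

/-- The estimate of the square root of a probability that is read off from a clock. -/
noncomputable def rootEst (m : ℕ) (y : Fin (4 * m + 2)) : ℝ := ‖clockRoot _ y - 1‖ / 2

theorem rootEst_nonneg (m : ℕ) (y : Fin (4 * m + 2)) : 0 ≤ rootEst m y := by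
  unfold rootEst; positivity

theorem rootEst_le_one (m : ℕ) (y : Fin (4 * m + 2)) : rootEst m y ≤ 1 := by
  unfold rootEst
  have := norm_sub_le (clockRoot _ y) 1
  rw [norm_clockRoot, norm_one] at this
  linarith

variable {X : Type*} [Fintype X] [DecidableEq X]

/-- The outcome `y` of phase estimation with clock amplitudes `c`. -/
noncomputable def clockAmp (Q : Matrix.unitaryGroup X ℂ) (v : X → ℂ) (M : ℕ) (c : ℕ → ℝ)
    (y : Fin M) : X → ℂ :=
  ∑ t ∈ Finset.range M, (((√(M : ℝ))⁻¹ : ℝ) * conj (clockRoot M y) ^ t * c t : ℂ) •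
    ((Q ^ t : Matrix.unitaryGroup X ℂ) : Matrix X X ℂ).mulVec v

theorem phaseClock_branch (m : ℕ) (hm : 0 < m) (Q : Matrix.unitaryGroup X ℂ) (v : X → ℂ)
    (y : Fin (4 * m + 2)) : (phaseClock m hm).branch Q v y = clockAmp Q v (4 * m + 2)
      (fun t => (√(∑ t ∈ Finset.range (4 * m + 2), bump m t ^ 2))⁻¹ * bump m t) y := by
  simp only [Clock.branch, clockAmp, phaseClock, fourierU_apply]
  rw [← Fin.sum_univ_eq_sum_range fun x =>
    (((√((4 * m + 2 : ℕ) : ℝ))⁻¹ : ℝ) * conj (clockRoot (4 * m + 2) y) ^ x *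
      ((√(∑ t ∈ Finset.range (4 * m + 2), bump m t ^ 2))⁻¹ * bump m x : ℝ) : ℂ) •
        ((Q ^ x : Matrix.unitaryGroup X ℂ) : Matrix X X ℂ).mulVec v]

theorem sum_nrmSq_clockAmp (Q : Matrix.unitaryGroup X ℂ) (v : X → ℂ) (M : ℕ) (c : ℕ → ℝ) :
    ∑ y, nrmSq (clockAmp Q v M c y) = (∑ t ∈ Finset.range M, c t ^ 2) * nrmSq v := by
  have h : ∀ y, clockAmp Q v M c y = ∑ t : Fin M, (fourierU M : Matrix (Fin M) (Fin M) ℂ) y t •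
      ((c t : ℂ) • ((Q ^ (t : ℕ) : Matrix.unitaryGroup X ℂ) : Matrix X X ℂ).mulVec v) := by
    intro y
    simp only [clockAmp, fourierU_apply, smul_smul]
    rw [← Fin.sum_univ_eq_sum_range (fun t => (((√(M : ℝ))⁻¹ : ℝ) * conj (clockRoot M y) ^ t * c t : ℂ) •
      ((Q ^ t : Matrix.unitaryGroup X ℂ) : Matrix X X ℂ).mulVec v)]
  simp only [h]
  rw [sum_nrmSq_fourier]
  simp only [nrmSq_smul, nrmSq_unitary]
  rw [← Finset.sum_mul, ← Fin.sum_univ_eq_sum_range (fun t => c t ^ 2)]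
  simp

/-- Summation by parts: applying `conj z • Q` shifts the summation index by one. The condition `c M
= 0` removes the term with `Q ^ (M + 1)` that would leave the clock. -/
theorem clockAmp_backDiff (Q : Matrix.unitaryGroup X ℂ) (v : X → ℂ) (M : ℕ) (c : ℕ → ℝ)
    (hc : c M = 0) (y : Fin (M + 1)) :
    clockAmp Q v (M + 1) c y - conj (clockRoot _ y) •
      (Q : Matrix X X ℂ).mulVec (clockAmp Q v (M + 1) c y) =
      clockAmp Q v (M + 1) (backDiff c) y := by
  unfold clockAmp
  rw [Matrix.mulVec_sum, Finset.smul_sum, Finset.sum_range_succ' _ M]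
  conv_lhs => enter [2]; rw [Finset.sum_range_succ]
  rw [Finset.sum_range_succ' _ M, hc]
  simp only [backDiff, Nat.add_one_ne_zero, if_false, Nat.add_sub_cancel, if_true, sub_zero,
    Complex.ofReal_zero, mul_zero, zero_smul, Matrix.mulVec_zero, smul_zero, add_zero]
  rw [add_sub_right_comm, ← Finset.sum_sub_distrib]
  congr 1
  refine Finset.sum_congr rfl fun t _ => ?_
  rw [Matrix.mulVec_smul, Matrix.mulVec_mulVec, ← Matrix.UnitaryGroup.mul_val, ← pow_succ',
    smul_smul, ← sub_smul]
  congr 1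
  push_cast
  ring

/-- `v` lies in a plane on which `Q` is a rotation whose angle `2 θ` has `sin θ ^ 2 = a`. -/
def RotatesBy (Q : Matrix.unitaryGroup X ℂ) (a : ℝ) (v : X → ℂ) : Prop :=
  (Q : Matrix X X ℂ).mulVec ((Q : Matrix X X ℂ).mulVec v) =
    (2 * (1 - 2 * a) : ℂ) • (Q : Matrix X X ℂ).mulVec v - v

variable {Q : Matrix.unitaryGroup X ℂ} {a : ℝ} {v w : X → ℂ}

theorem RotatesBy.smul (h : RotatesBy Q a v) (c : ℂ) : RotatesBy Q a (c • v) := by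
  unfold RotatesBy at *
  simp only [Matrix.mulVec_smul, h]
  module

theorem RotatesBy.zero : RotatesBy Q a 0 := by
  simp [RotatesBy]

theorem RotatesBy.add (h : RotatesBy Q a v) (h' : RotatesBy Q a w) : RotatesBy Q a (v + w) := by
  unfold RotatesBy at *
  simp only [Matrix.mulVec_add, h, h']
  module

theorem RotatesBy.sum {ι : Type*} (s : Finset ι) (f : ι → X → ℂ) (h : ∀ i ∈ s, RotatesBy Q a (f i)) :
    RotatesBy Q a (∑ i ∈ s, f i) :=
  Finset.sum_induction _ _ (fun _ _ => RotatesBy.add) RotatesBy.zero h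

theorem RotatesBy.mulVec (h : RotatesBy Q a v) : RotatesBy Q a ((Q : Matrix X X ℂ).mulVec v) := by
  unfold RotatesBy at *
  conv_lhs => rw [h, Matrix.mulVec_sub, Matrix.mulVec_smul]

theorem RotatesBy.pow (h : RotatesBy Q a v) (t : ℕ) :
    RotatesBy Q a (((Q ^ t : Matrix.unitaryGroup X ℂ) : Matrix X X ℂ).mulVec v) := by
  induction t with
  | zero => simpa using h
  | succ t ih =>
    rw [pow_succ', Matrix.UnitaryGroup.mul_val, ← Matrix.mulVec_mulVec]
    exact ih.mulVec

theorem RotatesBy.clockAmp_mem (h : RotatesBy Q a v) (M : ℕ) (c : ℕ → ℝ) (y : Fin M) :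
    RotatesBy Q a (clockAmp Q v M c y) :=
  RotatesBy.sum _ _ fun _ _ => (h.pow _).smul _

/-- The eigenvalues of `Q` on the plane both have distance `2 √a` from 1, so by the triangle
inequality through 1 their distance from `z` is at least `|‖z - 1‖ - 2 √a|`. Measuring from 1 avoids
angles and the ambiguity of their sign. -/
theorem RotatesBy.sq_mul_nrmSq_le (h : RotatesBy Q a v) (ha0 : 0 ≤ a) (ha1 : a ≤ 1) {z : ℂ}
    (hz : ‖z‖ = 1) : (‖z - 1‖ - 2 * √a) ^ 2 * nrmSq v ≤
      nrmSq (v - conj z • (Q : Matrix X X ℂ).mulVec v) := by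
  -- This is exp(2iθ) with sin² θ = a.
  set lam : ℂ := ⟨1 - 2 * a, 2 * √(a * (1 - a))⟩ with hlam
  have hb : 0 ≤ a * (1 - a) := mul_nonneg ha0 (by linarith)
  have hn : ‖lam‖ = 1 := by
    rw [← sq_eq_sq₀ (norm_nonneg _) zero_le_one, ← Complex.normSq_eq_norm_sq, Complex.normSq_apply]
    simp only [hlam]
    nlinarith [Real.mul_self_sqrt hb]
  have hn1 : ‖lam - 1‖ = 2 * √a := by
    rw [← sq_eq_sq₀ (norm_nonneg _) (by positivity), ← Complex.normSq_eq_norm_sq,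
      Complex.normSq_apply, mul_pow, Real.sq_sqrt ha0]
    simp only [hlam, Complex.sub_re, Complex.sub_im, Complex.one_re, Complex.one_im]
    nlinarith [Real.mul_self_sqrt hb]
  have hn2 : ‖conj lam - 1‖ = 2 * √a := by
    rw [← hn1, ← Complex.norm_conj (lam - 1), map_sub, map_one]
  have hre : lam + conj lam = (2 * (1 - 2 * a) : ℂ) := by
    rw [Complex.add_conj]; simp [hlam]
  have h1 : |‖z - 1‖ - 2 * √a| ≤ ‖lam - z‖ := by
    rw [← hn1, norm_sub_rev lam z, show z - lam = (z - 1) - (lam - 1) by ring]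
    exact abs_norm_sub_norm_le _ _
  have h2 : |‖z - 1‖ - 2 * √a| ≤ ‖conj lam - z‖ := by
    rw [← hn2, norm_sub_rev _ z, show z - conj lam = (z - 1) - (conj lam - 1) by ring]
    exact abs_norm_sub_norm_le _ _
  have h3 := (unitaryIsometry Q).mul_norm_le_norm_sub_smul hn (a := WithLp.toLp 2 v)
    (by rw [hre]; exact congrArg (WithLp.toLp 2) h) (abs_nonneg _) h1 h2
  have h4 : v - conj z • (Q : Matrix X X ℂ).mulVec v =
      (-conj z) • ((Q : Matrix X X ℂ).mulVec v - z • v) := by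
    rw [smul_sub, smul_smul, neg_mul, conj_mul_self_of_norm_eq_one hz]; module
  rw [h4, nrmSq_smul, norm_neg, Complex.norm_conj, hz, one_pow, one_mul, ← sq_abs, nrmSq_eq,
    nrmSq_eq, ← mul_pow]
  gcongr
  exact h3

/-- Two summations by parts trade the factor (error)⁴ for the second difference of the window;
Parseval then sums over the outcomes without any bound on the individual amplitudes. The clock has
two spare indices so that both the window and its first difference vanish at the last one. -/
theorem RotatesBy.sum_pow_four_mul_nrmSq_branch_le (h : RotatesBy Q a v) (ha0 : 0 ≤ a)
    (ha1 : a ≤ 1) (m : ℕ) (hm : 0 < m) :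
    ∑ y, (rootEst m y - √a) ^ 4 * nrmSq ((phaseClock m hm).branch Q v y) ≤
      2187 / (m : ℝ) ^ 4 * nrmSq v := by
  set G := ∑ t ∈ Finset.range (4 * m + 2), bump m t ^ 2 with hG
  have hm' : (0 : ℝ) < m := by exact_mod_cast hm
  have hG0 : 0 < G := lt_of_lt_of_le (by positivity) (le_sum_bump_sq m)
  set w : ℕ → ℝ := fun t => (√G)⁻¹ * bump m t with hw
  have hw1 : backDiff w = fun t => (√G)⁻¹ * backDiff (bump m) t := by
    funext t; exact backDiff_smul _ _ _
  have hw2 : ∀ t, backDiff (backDiff w) t = (√G)⁻¹ * backDiff (backDiff (bump m)) t := by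
    intro t; rw [hw1]; exact backDiff_smul _ _ _
  have hwM : w (4 * m + 1) = 0 := by simp [hw, bump_eq_zero]
  have hwM1 : backDiff w (4 * m + 1) = 0 := by
    rw [hw1]; simp [backDiff, bump_eq_zero]
  have hsum : ∑ t ∈ Finset.range (4 * m + 2), backDiff (backDiff w) t ^ 2 ≤
      16 * (2187 / (m : ℝ) ^ 4) := by
    simp only [hw2, mul_pow]
    rw [← Finset.mul_sum, inv_pow, Real.sq_sqrt hG0.le]
    calc G⁻¹ * _ ≤ G⁻¹ * (16 * 2187 / (m : ℝ) ^ 4 * G) := by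
          gcongr; exact sum_backDiff_backDiff_bump_le hm
      _ = _ := by field_simp
  have key : ∀ y, 16 * ((rootEst m y - √a) ^ 4 * nrmSq ((phaseClock m hm).branch Q v y)) ≤
      nrmSq (clockAmp Q v (4 * m + 2) (backDiff (backDiff w)) y) := by
    intro y
    have e1 := (h.clockAmp_mem (4 * m + 2) w y).sq_mul_nrmSq_le ha0 ha1 (norm_clockRoot y)
    have e2 := (h.clockAmp_mem (4 * m + 2) (backDiff w) y).sq_mul_nrmSq_le ha0 ha1 (norm_clockRoot y)
    rw [clockAmp_backDiff Q v (4 * m + 1) w hwM y] at e1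
    rw [clockAmp_backDiff Q v (4 * m + 1) _ hwM1 y] at e2
    rw [phaseClock_branch]
    calc 16 * ((rootEst m y - √a) ^ 4 * nrmSq (clockAmp Q v (4 * m + 2) w y))
        = (‖clockRoot _ y - 1‖ - 2 * √a) ^ 2 * ((‖clockRoot _ y - 1‖ - 2 * √a) ^ 2 *
          nrmSq (clockAmp Q v (4 * m + 2) w y)) := by unfold rootEst; ring
      _ ≤ _ := (mul_le_mul_of_nonneg_left e1 (sq_nonneg _)).trans e2
  have := Finset.sum_le_sum fun y (_ : y ∈ Finset.univ) => key y
  rw [← Finset.mul_sum, sum_nrmSq_clockAmp] at this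
  have h5 := mul_le_mul_of_nonneg_right hsum (nrmSq_nonneg v)
  nlinarith

end PhaseClock

/-! ### The Grover iterate as a rotation. -/

section Grover

open ComplexConjugate Classical

variable {X : Type*} [Fintype X] [DecidableEq X]

/-- The image of the basis state `x₀`. -/
noncomputable def col (U : Matrix.unitaryGroup X ℂ) (x₀ : X) : X → ℂ :=
  (U : Matrix X X ℂ).mulVec (Pi.single x₀ 1)

theorem col_apply (U : Matrix.unitaryGroup X ℂ) (x₀ x : X) : col U x₀ x = (U : Matrix X X ℂ) x x₀ := by
  simp [col]

theorem nrmSq_col (U : Matrix.unitaryGroup X ℂ) (x₀ : X) : nrmSq (col U x₀) = 1 := by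
  rw [col, nrmSq_unitary, nrmSq, Finset.sum_eq_single x₀] <;> simp +contextual

theorem col_mul (U V : Matrix.unitaryGroup X ℂ) (x₀ : X) :
    col (U * V) x₀ = (U : Matrix X X ℂ).mulVec (col V x₀) := by
  rw [col, col, Matrix.UnitaryGroup.mul_val, Matrix.mulVec_mulVec]

/-- The part of a vector that is supported on `good`. -/
noncomputable def restrictTo (good : X → Prop) (v : X → ℂ) : X → ℂ := fun x => if good x then v x else 0

/-- A product of two reflections: the first flips the good part, the second is the reflection `2
|u⟩⟨u| - 1` about the prepared state u. -/
theorem grover_mulVec (U : Matrix.unitaryGroup X ℂ) (x₀ : X) (good : X → Prop) (v : X → ℂ) :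
    (grover U x₀ good : Matrix X X ℂ).mulVec v =
      (2 * (star (col U x₀) ⬝ᵥ (v - (2 : ℂ) • restrictTo good v))) • col U x₀ -
        (v - (2 : ℂ) • restrictTo good v) := by
  have h1 : (signU good : Matrix X X ℂ).mulVec v = v - (2 : ℂ) • restrictTo good v := by
    funext x
    rw [signU_mulVec]
    by_cases h : good x <;> simp [restrictTo, h]
    ring
  have h2 : ∀ w : X → ℂ, (signU (fun x => x ≠ x₀) : Matrix X X ℂ).mulVec w =
      (2 * w x₀) • Pi.single x₀ 1 - w := by
    intro w
    funext x
    rw [signU_mulVec]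
    by_cases h : x = x₀
    · subst h; simp; ring
    · simp [h]
  have h3 : ∀ w : X → ℂ, ((U⁻¹ : Matrix.unitaryGroup X ℂ) : Matrix X X ℂ).mulVec w x₀ =
      star (col U x₀) ⬝ᵥ w := by
    intro w
    simp [Matrix.mulVec, dotProduct, Matrix.star_apply, col_apply]
  have h4 : ∀ w : X → ℂ, (U : Matrix X X ℂ).mulVec
      (((U⁻¹ : Matrix.unitaryGroup X ℂ) : Matrix X X ℂ).mulVec w) = w := by
    intro w
    rw [Matrix.mulVec_mulVec, ← Matrix.UnitaryGroup.mul_val, mul_inv_cancel]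
    simp
  rw [grover, Matrix.UnitaryGroup.mul_val, ← Matrix.mulVec_mulVec, h1, Matrix.UnitaryGroup.mul_val,
    ← Matrix.mulVec_mulVec, Matrix.UnitaryGroup.mul_val, ← Matrix.mulVec_mulVec, h2,
    Matrix.mulVec_sub, h4, Matrix.mulVec_smul, h3]
  rfl

variable (U : Matrix.unitaryGroup X ℂ) (x₀ : X) (good : X → Prop)

theorem grover_mulVec_restrictTo :
    (grover U x₀ good : Matrix X X ℂ).mulVec (restrictTo good (col U x₀)) =
      (-2 * nrmSq (restrictTo good (col U x₀)) : ℂ) • col U x₀ + restrictTo good (col U x₀) := by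
  set g := restrictTo good (col U x₀) with hg
  have h1 : restrictTo good g = g := by
    funext x; by_cases h : good x <;> simp [hg, restrictTo, h]
  have h2 : star (col U x₀) ⬝ᵥ g = nrmSq g := by
    rw [ofReal_nrmSq]
    refine Finset.sum_congr rfl fun x _ => ?_
    by_cases h : good x <;> simp [hg, restrictTo, h]
  rw [grover_mulVec, h1, show g - (2 : ℂ) • g = -g by module, dotProduct_neg, h2]
  module

theorem grover_mulVec_col :
    (grover U x₀ good : Matrix X X ℂ).mulVec (col U x₀) =
      (1 - 4 * nrmSq (restrictTo good (col U x₀)) : ℂ) • col U x₀ +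
        (2 : ℂ) • restrictTo good (col U x₀) := by
  set g := restrictTo good (col U x₀) with hg
  have h2 : star (col U x₀) ⬝ᵥ g = nrmSq g := by
    rw [ofReal_nrmSq]
    refine Finset.sum_congr rfl fun x _ => ?_
    by_cases h : good x <;> simp [hg, restrictTo, h]
  rw [grover_mulVec, dotProduct_sub, dotProduct_smul, ← hg, h2, ← ofReal_nrmSq, nrmSq_col]
  simp only [Complex.ofReal_one, smul_eq_mul]
  module

/-- The span of the prepared state and its good part is invariant. Both vectors matter: recording
the sampled element leaves the good part, while a uniformly chosen element leaves the whole prepared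
state. -/
theorem rotatesBy_grover_restrictTo : RotatesBy (grover U x₀ good)
    (nrmSq (restrictTo good (col U x₀))) (restrictTo good (col U x₀)) := by
  unfold RotatesBy
  rw [grover_mulVec_restrictTo, Matrix.mulVec_add, Matrix.mulVec_smul, grover_mulVec_restrictTo,
    grover_mulVec_col]
  module

theorem rotatesBy_grover_col : RotatesBy (grover U x₀ good)
    (nrmSq (restrictTo good (col U x₀))) (col U x₀) := by
  unfold RotatesBy
  rw [grover_mulVec_col, Matrix.mulVec_add, Matrix.mulVec_smul, Matrix.mulVec_smul,
    grover_mulVec_restrictTo, grover_mulVec_col]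
  module

theorem nrmSq_restrictTo_col_le_one : nrmSq (restrictTo good (col U x₀)) ≤ 1 := by
  rw [← nrmSq_col U x₀]
  refine Finset.sum_le_sum fun x _ => ?_
  by_cases h : good x <;> simp [restrictTo, h]

end Grover

/-! ### Amplitude estimation as a circuit. -/

section Realizable

variable {S T : Type*} [Fintype S] [DecidableEq S] [Fintype T] [DecidableEq T]

/-- The family `D` of distributions on `O`, depending on the unknown unitaries, is that of the
outcome of a quantum circuit with `k` uses of the latter. -/
def Realizable {O : Type} [DecidableEq O] (k : ℕ)
    (D : Matrix.unitaryGroup S ℂ → Matrix.unitaryGroup T ℂ → O → ℝ) : Prop :=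
  ∃ (W : Type) (_ : Fintype W) (_ : DecidableEq W) (b₀ : S × T × W)
    (F : Matrix.unitaryGroup S ℂ → Matrix.unitaryGroup T ℂ → Matrix.unitaryGroup (S × T × W) ℂ)
    (out : S × T × W → O), Implementable k F ∧
    ∀ A B o, D A B o = ∑ b, if out b = o then ‖col (F A B) b₀ b‖ ^ 2 else 0

variable {W : Type} [Fintype W] [DecidableEq W]

/-- One preparation of the state costs `k`, and each of at most `N` Grover iterates costs `2 * k`.
-/
theorem Implementable.realizable_amplitude_estimation {k : ℕ}
    {F : Matrix.unitaryGroup S ℂ → Matrix.unitaryGroup T ℂ → Matrix.unitaryGroup (S × T × W) ℂ}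
    (hF : Implementable k F) (b₀ : S × T × W) (good : S × T × W → Prop) {C : Type} [Fintype C]
    [DecidableEq C] [Nonempty C] (κ : Clock C) (N : ℕ) (hN : ∀ t, κ.time t ≤ N) :
    Realizable (k * (2 * N + 1)) fun A B y =>
      nrmSq (κ.branch (grover (F A B) b₀ good) (col (F A B) b₀) y) := by
  obtain ⟨c₀⟩ := ‹Nonempty C›
  obtain ⟨V, hV⟩ := exists_unitary_col κ.window κ.sum_window c₀
  let e := splitEquiv S T (Equiv.refl (W × C))
  let e' : S × T × (W × C) ≃ C × (S × T × W) := e.trans (Equiv.prodComm _ _)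
  have h0 := hF.lift (Equiv.refl (W × C))
  have h1 := (((Implementable.fixed (slice e' fun _ => κ.fourier)).mul
    (h0.controlled_grover_pow e b₀ (fun _ => good) κ.time N hN)).mul h0).mul
      (Implementable.fixed (slice e' fun _ => V))
  rw [show 0 + 2 * k * N + k + 0 = k * (2 * N + 1) by ring] at h1
  refine ⟨W × C, instFintypeProd W C, instDecidableEqProd, (b₀.1, b₀.2.1, (b₀.2.2, c₀)), _, fun b => b.2.2.2,
    h1, fun A B y => ?_⟩
  have hcol : ∀ b : S × T × (W × C), col ((slice e' fun _ => κ.fourier) *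
      (slice e fun r => grover (F A B) b₀ good ^ κ.time r) * (slice e fun _ => F A B) *
      (slice e' fun _ => V)) (b₀.1, b₀.2.1, (b₀.2.2, c₀)) b =
      κ.branch (grover (F A B) b₀ good) (col (F A B) b₀) (e b).2 (e b).1 := by
    have s1 : ∀ b, col (slice e' fun _ => V) (b₀.1, b₀.2.1, (b₀.2.2, c₀)) b =
        κ.window (e b).2 * (Pi.single b₀ 1 : S × T × W → ℂ) (e b).1 := by
      intro b
      rw [col_apply, slice_apply]
      by_cases h : (e b).1 = b₀
      · rw [if_pos (by simpa [e', e, splitEquiv] using h), h]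
        simpa [e', e, splitEquiv] using hV _
      · rw [if_neg (by simpa [e', e, splitEquiv] using h), Pi.single_eq_of_ne h, mul_zero]
    have s2 : ∀ b, col ((slice e fun _ => F A B) * slice e' fun _ => V)
        (b₀.1, b₀.2.1, (b₀.2.2, c₀)) b = κ.window (e b).2 * col (F A B) b₀ (e b).1 := by
      intro b
      rw [col_mul, slice_mulVec]
      simp only [s1, Equiv.apply_symm_apply]
      have : (fun x => κ.window (e b).2 * (Pi.single b₀ 1 : S × T × W → ℂ) x) =
        κ.window (e b).2 • (Pi.single b₀ 1 : S × T × W → ℂ) := rfl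
      rw [this, Matrix.mulVec_smul]
      rfl
    intro b
    rw [mul_assoc, mul_assoc, col_mul, slice_mulVec]
    have s3 : ∀ b, col ((slice e fun r => grover (F A B) b₀ good ^ κ.time r) *
        ((slice e fun _ => F A B) * slice e' fun _ => V)) (b₀.1, b₀.2.1, (b₀.2.2, c₀)) b =
        κ.window (e b).2 * (((grover (F A B) b₀ good ^ κ.time (e b).2 : Matrix.unitaryGroup _ ℂ) :
          Matrix _ _ ℂ).mulVec (col (F A B) b₀)) (e b).1 := by
      intro b
      rw [col_mul, slice_mulVec]
      simp only [s2, Equiv.apply_symm_apply]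
      have : (fun x => κ.window (e b).2 * col (F A B) b₀ x) =
        κ.window (e b).2 • col (F A B) b₀ := rfl
      rw [this, Matrix.mulVec_smul]
      rfl
    simp only [s3, e', Equiv.trans_apply, Equiv.prodComm_apply, Equiv.symm_trans_apply,
      Equiv.prodComm_symm, Equiv.apply_symm_apply, Prod.swap, Clock.branch, Matrix.mulVec,
      dotProduct, Finset.sum_apply, Pi.smul_apply, smul_eq_mul, mul_assoc]
  trans ∑ b : S × T × (W × C), if (e b).2 = y then
    ‖κ.branch (grover (F A B) b₀ good) (col (F A B) b₀) (e b).2 (e b).1‖ ^ 2 else 0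
  · rw [← e.symm.sum_comp, Fintype.sum_prod_type]
    simp only [Equiv.apply_symm_apply]
    simp [nrmSq]
  · refine Finset.sum_congr rfl fun b _ => ?_
    rw [← hcol b]
    rfl

end Realizable

/-! ### Sampling an element and estimating both of its probabilities coherently. -/

section SamplingCircuit

variable {S T : Type*} [Fintype S] [DecidableEq S] [Fintype T] [DecidableEq T]

theorem slice_mulVec_of_eq {Ω X R : Type*} [Fintype Ω] [DecidableEq Ω] [Fintype X] [DecidableEq X]
    [Fintype R] [DecidableEq R] (e : Ω ≃ X × R) (G : R → Matrix.unitaryGroup X ℂ) {v : Ω → ℂ}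
    {c : R → ℂ} {u : R → X → ℂ} (h : ∀ x r, v (e.symm (x, r)) = c r * u r x) (x : X) (r : R) :
    ((slice e G : Matrix Ω Ω ℂ).mulVec v) (e.symm (x, r)) =
      c r * (G r : Matrix X X ℂ).mulVec (u r) x := by
  rw [slice_mulVec]
  simp only [Equiv.apply_symm_apply, h]
  have : (fun x => c r * u r x) = c r • u r := rfl
  rw [this, Matrix.mulVec_smul]
  rfl

/-- The state of the first register after sampling the element `x`, for `c = true` by means of `A`,
and otherwise uniformly. -/
noncomputable def sampledState {n : ℕ} (A : Matrix.unitaryGroup S ℂ) (s₀ : S) (φ : S → Fin n)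
    (c : Bool) (x : Fin n) : S → ℂ :=
  if c then ((√2)⁻¹ : ℝ) • restrictTo (fun s => φ s = x) (col A s₀)
  else ((√(2 * n : ℝ))⁻¹ : ℝ) • col A s₀

/-- The Grover iterate for the preparation of the element `x`. -/
noncomputable def groverAt {n : ℕ} (A : Matrix.unitaryGroup S ℂ) (s₀ : S) (φ : S → Fin n)
    (x : Fin n) : Matrix.unitaryGroup S ℂ := grover A s₀ fun s => φ s = x

/-- Sorting the registers so that the workspace comes first. -/
def workEquiv (S T W : Type*) : S × T × W ≃ W × (S × T) where
  toFun a := (a.2.2, a.1, a.2.1)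
  invFun a := (a.2.1, a.2.2, a.1)
  left_inv _ := rfl
  right_inv _ := rfl

/-- Sorting the registers so that the two clocks come first. -/
def clockEquiv (S T P C L : Type*) : S × T × (P × C × L) ≃ C × (S × T × P × L) where
  toFun a := (a.2.2.2.1, a.1, a.2.1, a.2.2.1, a.2.2.2.2)
  invFun a := (a.2.1, a.2.2.1, a.2.2.2.1, a.1, a.2.2.2.2)
  left_inv _ := rfl
  right_inv _ := rfl

/-- Writing the sampled element into the register `Fin n`, which starts as `φ s₀`. -/
def recordPerm {n : ℕ} {R : Type*} (s₀ : S) (φ : S → Fin n) :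
    Equiv.Perm (S × T × ((Bool × Fin n) × R)) :=
  Function.Involutive.toPerm (fun a => (a.1, a.2.1, ((a.2.2.1.1,
    if a.2.2.1.1 then Equiv.swap (φ s₀) (φ a.1) a.2.2.1.2 else a.2.2.1.2), a.2.2.2))) (by
    rintro ⟨s, t, ⟨c, x⟩, r⟩
    cases c <;> simp)

-- The flag `c` is in equal superposition: the register `x` holds the element sampled by `A` for `c
-- = true` and a uniform one otherwise, hence the weight (p x + 1/n)/2. In both cases the
-- `S`-register is left in the Grover plane of `x`, so the same copy serves for amplitude
-- estimation. The cost is one use of each of `A` and `B`, and `2 * N` for each controlled power.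
-- The register `Fin L` stays uniform, for later use as a threshold.
set_option synthInstance.maxSize 1000 in
theorem exists_sampling_circuit {n L : ℕ} [NeZero L] (s₀ : S) (t₀ : T) (φ : S → Fin n)
    (ψ : T → Fin n) {C : Type} [Fintype C] [DecidableEq C] [Nonempty C] (κ : Clock C) (N : ℕ)
    (hN : ∀ t, κ.time t ≤ N) :
    ∃ (b₀ : S × T × ((Bool × Fin n) × (C × C) × Fin L))
      (F : Matrix.unitaryGroup S ℂ → Matrix.unitaryGroup T ℂ →
        Matrix.unitaryGroup (S × T × ((Bool × Fin n) × (C × C) × Fin L)) ℂ),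
      Implementable (2 + 4 * N) F ∧ ∀ A B s t c x y y' j,
        col (F A B) b₀ (s, t, ((c, x), (y, y'), j)) = ((√(L : ℝ))⁻¹ : ℝ) *
          κ.branch (groverAt A s₀ φ x) (sampledState A s₀ φ c x) y s *
          κ.branch (groverAt B t₀ ψ x) (col B t₀) y' t := by
  obtain ⟨c₀⟩ := ‹Nonempty C›
  let W := (Bool × Fin n) × (C × C) × Fin L
  -- For `c = true` the record starts at `φ s₀`, the value that the later swap exchanges with `φ s`.
  let χ : Bool × Fin n → ℂ := fun p =>
    if p.1 then (if p.2 = φ s₀ then ((√2)⁻¹ : ℝ) else 0) else ((√(2 * n : ℝ))⁻¹ : ℝ)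
  have hn : (n : ℝ) ≠ 0 := by have := (φ s₀).pos; exact_mod_cast this.ne'
  have hL : (L : ℝ) ≠ 0 := by exact_mod_cast NeZero.ne L
  have hχ : ∑ p, ‖χ p‖ ^ 2 = 1 := by
    rw [Fintype.sum_prod_type]
    simp only [χ, Fintype.sum_bool, if_true, Bool.false_eq_true, if_false, Complex.norm_real,
      Real.norm_eq_abs, sq_abs, inv_pow, Finset.sum_const, Finset.card_univ, Fintype.card_fin,
      nsmul_eq_mul]
    rw [Finset.sum_eq_single (φ s₀) (by intro b _ hb; simp [hb]) (by simp)]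
    simp only [if_true, Complex.norm_real, Real.norm_eq_abs, sq_abs, inv_pow]
    rw [Real.sq_sqrt (by norm_num), Real.sq_sqrt (by positivity)]
    field_simp
    norm_num
  let π : W → ℂ := fun w => χ w.1 * (κ.prod κ).window w.2.1 * ((√(L : ℝ))⁻¹ : ℝ)
  have hπ : ∑ w, ‖π w‖ ^ 2 = 1 := by
    simp only [π, W, norm_mul, mul_pow]
    rw [Fintype.sum_prod_type]
    simp only [Fintype.sum_prod_type (fun x : (C × C) × Fin L => _), Finset.sum_const,
      Finset.card_univ, Fintype.card_fin, nsmul_eq_mul, Complex.norm_real, Real.norm_eq_abs, sq_abs,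
      inv_pow, Real.sq_sqrt (Nat.cast_nonneg L)]
    simp only [← Finset.mul_sum, mul_left_comm (L : ℝ), mul_inv_cancel₀ hL,
      (κ.prod κ).sum_window, hχ, mul_one]
  let w₀ : W := ((true, φ s₀), (c₀, c₀), 0)
  obtain ⟨V, hV⟩ := exists_unitary_col π hπ w₀
  let b₀ : S × T × W := (s₀, t₀, w₀)
  let eW := workEquiv S T W
  let eA : S × T × W ≃ S × (T × W) := Equiv.refl _
  let eB := secondEquiv S T W
  let eC := clockEquiv S T (Bool × Fin n) (C × C) (Fin L)
  have i1 : Implementable 0 fun (_ : Matrix.unitaryGroup S ℂ) (_ : Matrix.unitaryGroup T ℂ) =>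
    slice eW fun _ => V := .fixed _
  have i4 : Implementable 0 fun (_ : Matrix.unitaryGroup S ℂ) (_ : Matrix.unitaryGroup T ℂ) =>
    permU (recordPerm (T := T) (R := (C × C) × Fin L) s₀ φ) := .fixed _
  have i5 := (implementable_A (S := S) (T := T) (W := W)).controlled_grover_pow eA s₀
    (fun r s => φ s = r.2.1.2) (fun r => κ.time r.2.2.1.1) N fun _ => hN _
  have i6 := (implementable_B (S := S) (T := T) (W := W)).controlled_grover_pow eB t₀
    (fun r t => ψ t = r.2.1.2) (fun r => κ.time r.2.2.1.2) N fun _ => hN _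
  have i7 : Implementable 0 fun (_ : Matrix.unitaryGroup S ℂ) (_ : Matrix.unitaryGroup T ℂ) =>
    slice eC fun _ => (κ.prod κ).fourier := .fixed _
  have i := i7.mul (i6.mul (i5.mul (i4.mul (implementable_B.mul (implementable_A.mul i1)))))
  rw [show 0 + (2 * 1 * N + (2 * 1 * N + (0 + (1 + (1 + 0))))) = 2 + 4 * N by ring] at i
  refine ⟨b₀, _, i, fun A B s t c x y y' j => ?_⟩
  have s1 : ∀ s t w, col (slice eW fun _ => V) b₀ (s, t, w) =
      π w * ((Pi.single s₀ 1 : S → ℂ) s * (Pi.single t₀ 1 : T → ℂ) t) := by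
    intro s t w
    rw [col_apply, slice_apply]
    by_cases h : s = s₀ <;> by_cases h' : t = t₀ <;>
      simp [eW, workEquiv, b₀, h, h', hV]
  have s2 : ∀ s t w, col ((slice eA fun _ => A) * slice eW fun _ => V) b₀ (s, t, w) =
      π w * (col A s₀ s * (Pi.single t₀ 1 : T → ℂ) t) := by
    intro s t w
    rw [col_mul]
    refine (slice_mulVec_of_eq eA _ (c := fun r => π r.2 * (Pi.single t₀ 1 : T → ℂ) r.1)
      (u := fun _ => Pi.single s₀ 1) (fun s r => ?_) s (t, w)).trans ?_
    · refine (s1 s r.1 r.2).trans ?_; ring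
    · simp only [col]; ring
  have s3 : ∀ s t w, col ((slice eB fun _ => B) * ((slice eA fun _ => A) * slice eW fun _ => V)) b₀
      (s, t, w) = π w * (col A s₀ s * col B t₀ t) := by
    intro s t w
    rw [col_mul]
    refine (slice_mulVec_of_eq eB _ (c := fun r => π r.2 * col A s₀ r.1)
      (u := fun _ => Pi.single t₀ 1) (fun t r => ?_) t (s, w)).trans ?_
    · refine (s2 r.1 t r.2).trans ?_; ring
    · simp only [col]; ring
  have s4 : ∀ s t w, col (permU (recordPerm (T := T) (R := (C × C) × Fin L) s₀ φ) *
      ((slice eB fun _ => B) * ((slice eA fun _ => A) * slice eW fun _ => V))) b₀ (s, t, w) =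
      ((κ.prod κ).window w.2.1 * ((√(L : ℝ))⁻¹ : ℝ)) * (sampledState A s₀ φ w.1.1 w.1.2 s *
        col B t₀ t) := by
    rintro s t ⟨⟨c, x⟩, r⟩
    rw [col_mul, permU_mulVec]
    refine (s3 _ _ _).trans ?_
    simp only [π, χ, sampledState]
    cases c
    · simp only [Bool.false_eq_true, if_false,
        Pi.smul_apply, Complex.real_smul]
      ring
    · simp only [if_true, restrictTo, Pi.smul_apply,
        Complex.real_smul]
      by_cases h : φ s = x
      · subst h; simp; ring
      -- The swap takes only `φ s` to `φ s₀`, so a record `x ≠ φ s` has amplitude 0.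
      · have : Equiv.swap (φ s₀) (φ s) x ≠ φ s₀ := by
          intro h'
          rw [Equiv.swap_apply_eq_iff, Equiv.swap_apply_left] at h'
          exact h h'.symm
        simp [h, this]
  have s5 : ∀ s t w, col ((slice eA fun r => grover A s₀ (fun s => φ s = r.2.1.2) ^
      κ.time r.2.2.1.1) * (permU (recordPerm (T := T) (R := (C × C) × Fin L) s₀ φ) *
      ((slice eB fun _ => B) * ((slice eA fun _ => A) * slice eW fun _ => V)))) b₀ (s, t, w) =
      ((κ.prod κ).window w.2.1 * ((√(L : ℝ))⁻¹ : ℝ)) *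
        (((groverAt A s₀ φ w.1.2 ^ κ.time w.2.1.1 : Matrix.unitaryGroup S ℂ) : Matrix S S ℂ).mulVec
          (sampledState A s₀ φ w.1.1 w.1.2) s * col B t₀ t) := by
    intro s t w
    rw [col_mul]
    refine (slice_mulVec_of_eq eA _
      (c := fun r => (κ.prod κ).window r.2.2.1 * ((√(L : ℝ))⁻¹ : ℝ) * col B t₀ r.1)
      (u := fun r => sampledState A s₀ φ r.2.1.1 r.2.1.2) (fun s r => ?_) s (t, w)).trans ?_
    · refine (s4 s r.1 r.2).trans ?_; ring
    · simp only [groverAt]; ring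
  have s6 : ∀ s t w, col ((slice eB fun r => grover B t₀ (fun t => ψ t = r.2.1.2) ^
      κ.time r.2.2.1.2) * ((slice eA fun r => grover A s₀ (fun s => φ s = r.2.1.2) ^
      κ.time r.2.2.1.1) * (permU (recordPerm (T := T) (R := (C × C) × Fin L) s₀ φ) *
      ((slice eB fun _ => B) * ((slice eA fun _ => A) * slice eW fun _ => V))))) b₀ (s, t, w) =
      ((κ.prod κ).window w.2.1 * ((√(L : ℝ))⁻¹ : ℝ)) *
        (((groverAt A s₀ φ w.1.2 ^ κ.time w.2.1.1 : Matrix.unitaryGroup S ℂ) : Matrix S S ℂ).mulVec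
          (sampledState A s₀ φ w.1.1 w.1.2) s *
        ((groverAt B t₀ ψ w.1.2 ^ κ.time w.2.1.2 : Matrix.unitaryGroup T ℂ) : Matrix T T ℂ).mulVec
          (col B t₀) t) := by
    intro s t w
    rw [col_mul]
    refine (slice_mulVec_of_eq eB _
      (c := fun r => (κ.prod κ).window r.2.2.1 * ((√(L : ℝ))⁻¹ : ℝ) *
        ((groverAt A s₀ φ r.2.1.2 ^ κ.time r.2.2.1.1 : Matrix.unitaryGroup S ℂ) :
          Matrix S S ℂ).mulVec (sampledState A s₀ φ r.2.1.1 r.2.1.2) r.1)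
      (u := fun r => col B t₀) (fun t r => ?_) t (s, w)).trans ?_
    · refine (s5 r.1 t r.2).trans ?_; ring
    · simp only [groverAt]; ring
  rw [col_mul]
  refine (slice_mulVec eC _ _ _).trans ?_
  simp only [Matrix.mulVec, dotProduct]
  rw [Fintype.sum_prod_type]
  simp only [Clock.branch, Finset.sum_apply, Pi.smul_apply, smul_eq_mul]
  rw [mul_assoc, Finset.sum_mul_sum, Finset.mul_sum]
  refine Finset.sum_congr rfl fun z _ => ?_
  rw [Finset.mul_sum]
  refine Finset.sum_congr rfl fun z' _ => ?_
  rw [show eC.symm ((z, z'), (eC (s, t, ((c, x), (y, y'), j))).2) = (s, t, ((c, x), (z, z'), j))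
    from rfl, s6]
  simp only [Clock.prod, eC, clockEquiv, Equiv.coe_fn_mk, Matrix.kroneckerMap_apply]
  ring

end SamplingCircuit

/-! ### Independent runs, and passage to `QAlgorithm`. -/

section RealizableClosure

variable {S T : Type*} [Fintype S] [DecidableEq S] [Fintype T] [DecidableEq T]
  {O O' : Type} [DecidableEq O] [DecidableEq O'] {k k' : ℕ}
  {D : Matrix.unitaryGroup S ℂ → Matrix.unitaryGroup T ℂ → O → ℝ}
  {D' : Matrix.unitaryGroup S ℂ → Matrix.unitaryGroup T ℂ → O' → ℝ}

theorem Realizable.nonneg (h : Realizable k D) (A : Matrix.unitaryGroup S ℂ)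
    (B : Matrix.unitaryGroup T ℂ) (o : O) : 0 ≤ D A B o := by
  obtain ⟨W, _, _, b₀, F, out, -, h⟩ := h
  rw [h]
  exact Finset.sum_nonneg fun b _ => by split_ifs <;> positivity

theorem Realizable.sum_eq_one [Fintype O] (h : Realizable k D) (A : Matrix.unitaryGroup S ℂ)
    (B : Matrix.unitaryGroup T ℂ) : ∑ o, D A B o = 1 := by
  obtain ⟨W, _, _, b₀, F, out, -, h⟩ := h
  simp only [h]
  rw [Finset.sum_comm]
  simpa [nrmSq] using nrmSq_col (F A B) b₀

theorem Realizable.equiv (h : Realizable k D) (e : O ≃ O') :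
    Realizable k fun A B o' => D A B (e.symm o') := by
  obtain ⟨W, i1, i2, b₀, F, out, hF, h⟩ := h
  refine ⟨W, i1, i2, b₀, F, fun b => e (out b), hF, fun A B o' => ?_⟩
  simp only [h, Equiv.eq_symm_apply]

theorem Realizable.congr {E : Matrix.unitaryGroup S ℂ → Matrix.unitaryGroup T ℂ → O → ℝ}
    (h : Realizable k D) (hE : ∀ A B o, E A B o = D A B o) : Realizable k E := by
  have : E = D := by funext A B o; exact hE A B o
  exact this ▸ h

/-- The second run needs fresh registers `S` and `T`: their initial basis states wait in a storage
register and are exchanged with what the first run leaves. The storage is indexed by `Fin`, since a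
workspace has to be in `Type` while `S` and `T` may be in other universes. -/
theorem Realizable.prod (h : Realizable k D) (h' : Realizable k' D') :
    Realizable (k + k') fun A B (o : O × O') => D A B o.1 * D' A B o.2 := by
  obtain ⟨W, _, _, b, F, out, hF, h⟩ := h
  obtain ⟨W', _, _, b', F', out', hF', h'⟩ := h'
  let eS := Fintype.equivFin S
  let eT := Fintype.equivFin T
  let K := Fin (Fintype.card S) × Fin (Fintype.card T)
  let e1 : S × T × (W × W' × K) ≃ (S × T × W) × (W' × K) := splitEquiv S T (Equiv.refl _)
  let e2 : S × T × (W × W' × K) ≃ (S × T × W') × (W × K) := splitEquiv S T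
    ⟨fun a => (a.2.1, a.1, a.2.2), fun a => (a.2.1, a.1, a.2.2), fun _ => rfl, fun _ => rfl⟩
  let σ : Equiv.Perm (S × T × (W × W' × K)) := Function.Involutive.toPerm
    (fun a => (eS.symm a.2.2.2.2.1, eT.symm a.2.2.2.2.2, (a.2.2.1, a.2.2.2.1, (eS a.1, eT a.2.1))))
    (by rintro ⟨s, t, w, w', i, j⟩; simp)
  let b₀ : S × T × (W × W' × K) := (b.1, b.2.1, (b.2.2, b'.2.2, (eS b'.1, eT b'.2.1)))
  have i := (hF'.lift (W' := W × W' × K) (C := W × K)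
    ⟨fun a => (a.2.1, a.1, a.2.2), fun a => (a.2.1, a.1, a.2.2), fun _ => rfl, fun _ => rfl⟩).mul
    ((Implementable.fixed (permU σ)).mul (hF.lift (Equiv.refl (W × (W' × K)))))
  rw [show k' + (0 + k) = k + k' by ring] at i
  refine ⟨W × W' × K, instFintypeProd _ _, instDecidableEqProd, b₀, _,
    fun a => (out (eS.symm a.2.2.2.2.1, eT.symm a.2.2.2.2.2, a.2.2.1), out' (a.1, a.2.1, a.2.2.2.1)),
    i, fun A B o => ?_⟩
  have s1 : ∀ a, col (slice e1 fun _ => F A B) b₀ (e1.symm a) =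
      (Pi.single (b'.2.2, (eS b'.1, eT b'.2.1)) 1 : W' × K → ℂ) a.2 * col (F A B) b a.1 := by
    intro a
    rw [col_apply, slice_apply, Equiv.apply_symm_apply]
    by_cases h : a.2 = (b'.2.2, (eS b'.1, eT b'.2.1))
    · rw [if_pos (by rw [h]; rfl), h, Pi.single_eq_same, one_mul, col_apply]
      rfl
    · rw [if_neg (by exact h), Pi.single_eq_of_ne h, zero_mul]
  have s2 : ∀ a, col (permU σ * slice e1 fun _ => F A B) b₀ (e2.symm a) =
      col (F A B) b (eS.symm a.2.2.1, eT.symm a.2.2.2, a.2.1) *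
        (Pi.single b' 1 : S × T × W' → ℂ) a.1 := by
    rintro ⟨⟨s, t, w'⟩, w, i, j⟩
    rw [col_mul, permU_mulVec]
    refine (s1 ((eS.symm i, eT.symm j, w), (w', (eS s, eT t)))).trans ?_
    rw [mul_comm]
    congr 1
    by_cases h : (s, t, w') = b'
    · subst h; simp
    · rw [Pi.single_eq_of_ne h, Pi.single_eq_of_ne]
      contrapose! h
      obtain ⟨h1, h2⟩ := Prod.ext_iff.1 h
      obtain ⟨h3, h4⟩ := Prod.ext_iff.1 h2
      exact Prod.ext (eS.injective h3) (Prod.ext (eT.injective h4) h1)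
  have s3 : ∀ x r, col ((slice e2 fun _ => F' A B) * (permU σ * slice e1 fun _ => F A B)) b₀
      (e2.symm (x, r)) = col (F A B) b (eS.symm r.2.1, eT.symm r.2.2, r.1) *
        col (F' A B) b' x := by
    intro x r
    rw [col_mul]
    exact slice_mulVec_of_eq e2 _
      (c := fun r => col (F A B) b (eS.symm r.2.1, eT.symm r.2.2, r.1))
      (u := fun _ => Pi.single b' 1) (fun x r => s2 (x, r)) x r
  let g : (S × T × W') × (W × K) ≃ (S × T × W') × (S × T × W) := Equiv.prodCongr (Equiv.refl _)
    ⟨fun r => (eS.symm r.2.1, eT.symm r.2.2, r.1), fun r => (r.2.2, (eS r.1, eT r.2.1)),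
      fun r => by simp, fun r => by simp⟩
  trans ∑ a : (S × T × W') × (S × T × W), if (out a.2, out' a.1) = o then
    ‖col (F A B) b a.2 * col (F' A B) b' a.1‖ ^ 2 else 0
  · simp only [h, h']
    refine Eq.trans ?_ (Fintype.sum_prod_type _).symm
    rw [Finset.sum_mul_sum, Finset.sum_comm]
    refine Finset.sum_congr rfl fun x _ => ?_
    refine Finset.sum_congr rfl fun y _ => ?_
    by_cases h1 : out y = o.1 <;> by_cases h2 : out' x = o.2 <;>
      simp [Prod.ext_iff, h1, h2, mul_pow]
  · rw [← g.sum_comp, ← e2.symm.sum_comp]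
    refine Finset.sum_congr rfl fun a _ => ?_
    rw [show col (F A B) b (g a).2 * col (F' A B) b' (g a).1 = _ from (s3 a.1 a.2).symm]
    rfl

theorem Realizable.unit [Nonempty S] [Nonempty T] : Realizable 0
    fun (_ : Matrix.unitaryGroup S ℂ) (_ : Matrix.unitaryGroup T ℂ) (_ : Unit) => (1 : ℝ) := by
  obtain ⟨s⟩ := ‹Nonempty S›
  obtain ⟨t⟩ := ‹Nonempty T›
  refine ⟨Unit, inferInstance, inferInstance, (s, t, ()), _, fun _ => (), .fixed 1, fun A B o => ?_⟩
  simpa [nrmSq] using (nrmSq_col (1 : Matrix.unitaryGroup (S × T × Unit) ℂ) (s, t, ())).symm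

theorem Realizable.uniform [Nonempty S] [Nonempty T] (m : ℕ) [NeZero m] : Realizable 0
    fun (_ : Matrix.unitaryGroup S ℂ) (_ : Matrix.unitaryGroup T ℂ) (_ : Fin m) => (m : ℝ)⁻¹ := by
  obtain ⟨s⟩ := ‹Nonempty S›
  obtain ⟨t⟩ := ‹Nonempty T›
  have hm : (m : ℝ) ≠ 0 := by exact_mod_cast NeZero.ne m
  obtain ⟨V, hV⟩ := exists_unitary_col
    (fun b : S × T × Fin m => if b.1 = s ∧ b.2.1 = t then (((√(m : ℝ))⁻¹ : ℝ) : ℂ) else 0) (by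
      rw [Fintype.sum_prod_type, Finset.sum_eq_single s (by intro x _ h; simp [h]) (by simp),
        Fintype.sum_prod_type, Finset.sum_eq_single t (by intro x _ h; simp [h]) (by simp)]
      simp [hm]) (s, t, 0)
  refine ⟨Fin m, inferInstance, inferInstance, (s, t, 0), _, fun b => b.2.2, .fixed V,
    fun A B o => ?_⟩
  simp only [col_apply, hV]
  rw [Fintype.sum_prod_type, Finset.sum_eq_single s (by intro x _ h; simp [h]) (by simp),
    Fintype.sum_prod_type, Finset.sum_eq_single t (by intro x _ h; simp [h]) (by simp)]
  simp

theorem Realizable.pi [Nonempty S] [Nonempty T] (h : Realizable k D) (R : ℕ) :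
    Realizable (R * k) fun A B (o : Fin R → O) => ∏ i, D A B (o i) := by
  induction R with
  | zero =>
    rw [zero_mul]
    exact (Realizable.unit.equiv (Equiv.ofUnique Unit (Fin 0 → O))).congr fun A B o => by simp
  | succ R ih =>
    rw [Nat.succ_mul, add_comm (R * k)]
    refine ((h.prod ih).equiv (Fin.consEquiv fun _ => O)).congr fun A B o => ?_
    rw [Fin.prod_univ_succ]
    rfl

theorem exists_qAlgorithm_of_realizable [Fintype O] (h : Realizable k D) (g : O → ℝ) :
    ∃ 𝒜 : QAlgorithm S T, 𝒜.numSamples = k ∧ ∀ A B (E : Set ℝ),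
      𝒜.outputProb A B E = ∑ o, (g ⁻¹' E).indicator (D A B) o := by
  obtain ⟨W, i1, i2, b₀, F, out, ⟨l, hl, hF⟩, h⟩ := h
  refine ⟨⟨W, b₀, l, fun b => g (out b)⟩, hl, fun A B E => ?_⟩
  have hrun : ∀ (l : List (QStep S T W)) (v : S × T × W → ℂ),
      l.foldl (fun v g => (g.op A B).mulVec v) v =
      ((l.map (QStep.opU A B)).reverse.prod : Matrix.unitaryGroup (S × T × W) ℂ).1.mulVec v := by
    intro l
    induction l with
    | nil => intro v; simp
    | cons s l ih =>
      intro v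
      rw [List.foldl_cons, ih, List.map_cons, List.reverse_cons, List.prod_append,
        Matrix.UnitaryGroup.mul_val, ← Matrix.mulVec_mulVec]
      simp [QStep.opU]
  have hfin : ∀ b, QAlgorithm.finalState ⟨W, b₀, l, fun b => g (out b)⟩ A B b =
      col (F A B) b₀ b := by
    intro b
    rw [QAlgorithm.finalState, hrun, hF]
    rfl
  classical
  calc _ = ∑ b, ∑ o, if out b = o then (if g o ∈ E then ‖col (F A B) b₀ b‖ ^ 2 else 0) else 0 := by
        refine Finset.sum_congr rfl fun b _ => ?_
        rw [Finset.sum_ite_eq, if_pos (Finset.mem_univ _), Set.indicator_apply, hfin]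
        rfl
    _ = ∑ o, ∑ b, if out b = o then (if g o ∈ E then ‖col (F A B) b₀ b‖ ^ 2 else 0) else 0 :=
        Finset.sum_comm
    _ = _ := by
        refine Finset.sum_congr rfl fun o _ => ?_
        by_cases ho : g o ∈ E <;> simp [ho, h]

end RealizableClosure

/-! ### Estimators: sums, repetition, random offsets. -/

section EstimatesWithin

variable {S T : Type*} [Fintype S] [DecidableEq S] [Fintype T] [DecidableEq T]

/-- With `k` uses of the unknown unitaries, the real number `tgt A B` can be estimated up to an
error of at most `lam`, except with probability at most `η`. -/
def EstimatesWithin (k : ℕ) (η lam : ℝ)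
    (tgt : Matrix.unitaryGroup S ℂ → Matrix.unitaryGroup T ℂ → ℝ) : Prop :=
  ∃ (O : Type) (_ : Fintype O) (_ : DecidableEq O)
    (D : Matrix.unitaryGroup S ℂ → Matrix.unitaryGroup T ℂ → O → ℝ) (g : O → ℝ),
    Realizable k D ∧ ∀ A B, ∑ o, (if lam < |g o - tgt A B| then D A B o else 0) ≤ η

variable {k k' : ℕ} {η η' lam lam' : ℝ}
  {f f' : Matrix.unitaryGroup S ℂ → Matrix.unitaryGroup T ℂ → ℝ}

/-- Changing the target absorbs a deterministic bias into the error. -/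
theorem EstimatesWithin.mono (h : EstimatesWithin k η lam f) (hη : η ≤ η')
    (hf : ∀ A B, lam + |f A B - f' A B| ≤ lam') : EstimatesWithin k η' lam' f' := by
  obtain ⟨O, i1, i2, D, g, hD, h⟩ := h
  refine ⟨O, i1, i2, D, g, hD, fun A B => le_trans (Finset.sum_le_sum fun o _ => ?_)
    ((h A B).trans hη)⟩
  have h0 := hD.nonneg A B o
  by_cases h1 : lam < |g o - f A B|
  · rw [if_pos h1]; split_ifs <;> simp [h0]
  · rw [if_neg h1, if_neg]
    have h2 := abs_add_le (g o - f A B) (f A B - f' A B)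
    rw [sub_add_sub_cancel] at h2
    linarith [hf A B]

theorem EstimatesWithin.affine (h : EstimatesWithin k η lam f) (c d : ℝ) :
    EstimatesWithin k η (|c| * lam) fun A B => c * f A B + d := by
  obtain ⟨O, i1, i2, D, g, hD, h⟩ := h
  refine ⟨O, i1, i2, D, fun o => c * g o + d, hD, fun A B =>
    le_trans (Finset.sum_le_sum fun o _ => ?_) (h A B)⟩
  have h0 := hD.nonneg A B o
  by_cases h1 : lam < |g o - f A B|
  · rw [if_pos h1]; split_ifs <;> simp [h0]
  · rw [if_neg h1, if_neg]
    rw [show c * g o + d - (c * f A B + d) = c * (g o - f A B) by ring, abs_mul, not_lt]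
    exact mul_le_mul_of_nonneg_left (not_lt.1 h1) (abs_nonneg c)

theorem EstimatesWithin.add (h : EstimatesWithin k η lam f) (h' : EstimatesWithin k' η' lam' f') :
    EstimatesWithin (k + k') (η + η') (lam + lam') fun A B => f A B + f' A B := by
  obtain ⟨O, _, _, D, g, hD, h⟩ := h
  obtain ⟨O', _, _, D', g', hD', h'⟩ := h'
  refine ⟨O × O', inferInstance, inferInstance, _, fun o => g o.1 + g' o.2, hD.prod hD',
    fun A B => ?_⟩
  rw [Fintype.sum_prod_type]
  calc _ ≤ ∑ o, ∑ o', ((if lam < |g o - f A B| then D A B o else 0) * D' A B o' +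
        D A B o * if lam' < |g' o' - f' A B| then D' A B o' else 0) := by
        refine Finset.sum_le_sum fun o _ => Finset.sum_le_sum fun o' _ => ?_
        have h0 := hD.nonneg A B o
        have h0' := hD'.nonneg A B o'
        by_cases h1 : lam < |g o - f A B| <;> by_cases h2 : lam' < |g' o' - f' A B|
        · rw [if_pos h1, if_pos h2]; split_ifs <;> nlinarith [mul_nonneg h0 h0']
        · rw [if_pos h1, if_neg h2]; split_ifs <;> nlinarith [mul_nonneg h0 h0']
        · rw [if_neg h1, if_pos h2]; split_ifs <;> nlinarith [mul_nonneg h0 h0']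
        · rw [if_neg h1, if_neg h2, if_neg]
          · simp
          · have h3 := abs_add_le (g o - f A B) (g' o' - f' A B)
            rw [show g o - f A B + (g' o' - f' A B) = g o + g' o' - (f A B + f' A B) by ring] at h3
            dsimp only
            linarith
    _ = (∑ o, if lam < |g o - f A B| then D A B o else 0) +
        ∑ o', if lam' < |g' o' - f' A B| then D' A B o' else 0 := by
        simp only [Finset.sum_add_distrib, ← Finset.mul_sum, ← Finset.sum_mul, hD.sum_eq_one,
          hD'.sum_eq_one, mul_one, one_mul]
    _ ≤ _ := add_le_add (h A B) (h' A B)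

theorem EstimatesWithin.const [Nonempty S] [Nonempty T] {c : ℝ} (h : ∀ A B, |c - f A B| ≤ lam) :
    EstimatesWithin 0 0 lam f :=
  ⟨Unit, inferInstance, inferInstance, _, fun _ => c, Realizable.unit, fun A B => by
    simp [not_lt.2 (h A B)]⟩

/-- Output any value within `lam` of more than half of the estimates. If more than half of them are
good, the two majorities share an estimate, so the output is within `2 * lam` of the target. -/
theorem EstimatesWithin.repeat [Nonempty S] [Nonempty T] (h : EstimatesWithin k η lam f)
    (hη : η ≤ 1 / 16) (R : ℕ) : EstimatesWithin (R * k) ((1 / 2) ^ R) (2 * lam) f := by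
  classical
  obtain ⟨O, _, _, D, g, hD, h⟩ := h
  let maj : (Fin R → O) → ℝ → Prop := fun o v =>
    R < 2 * (Finset.univ.filter fun i => |g (o i) - v| ≤ lam).card
  obtain ⟨pick, hpick⟩ : ∃ pick : (Fin R → O) → ℝ, ∀ o v, maj o v → maj o (pick o) := by
    refine ⟨fun o => if h : ∃ v, maj o v then h.choose else 0, fun o v hv => ?_⟩
    have hex : ∃ v, maj o v := ⟨v, hv⟩
    simp only [dif_pos hex]
    exact hex.choose_spec
  refine ⟨Fin R → O, inferInstance, inferInstance, _, pick, hD.pi R, fun A B => ?_⟩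
  set bad : O → Prop := fun o => lam < |g o - f A B| with hbad
  have key : ∀ o : Fin R → O,
      2 * lam < |pick o - f A B| →
      R ≤ 2 * (Finset.univ.filter fun i => bad (o i)).card := by
    intro o ho
    by_contra! hlt
    have hcard := Finset.card_filter_add_card_filter_not (s := (Finset.univ : Finset (Fin R)))
      fun i => bad (o i)
    rw [Finset.card_univ, Fintype.card_fin] at hcard
    have hgood : (Finset.univ.filter fun i => ¬ bad (o i)) =
        Finset.univ.filter fun i => |g (o i) - f A B| ≤ lam := by
      ext i; simp [hbad]
    rw [hgood] at hcard
    have hv : maj o (pick o) := hpick o (f A B) (by simp only [maj]; omega)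
    generalize pick o = v at hv ho
    simp only [maj] at hv
    have hne : ((Finset.univ.filter fun i => |g (o i) - v| ≤ lam) ∩
        Finset.univ.filter fun i => |g (o i) - f A B| ≤ lam).Nonempty := by
      rw [← Finset.card_pos]
      have h1 := Finset.card_union_add_card_inter
        (Finset.univ.filter fun i => |g (o i) - v| ≤ lam)
        (Finset.univ.filter fun i => |g (o i) - f A B| ≤ lam)
      have h2 := Finset.card_le_univ ((Finset.univ.filter fun i => |g (o i) - v| ≤ lam) ∪
        Finset.univ.filter fun i => |g (o i) - f A B| ≤ lam)
      rw [Fintype.card_fin] at h2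
      omega
    obtain ⟨i, hi⟩ := hne
    simp only [Finset.mem_inter, Finset.mem_filter, Finset.mem_univ, true_and] at hi
    have h3 := abs_sub_le v (g (o i)) (f A B)
    rw [abs_sub_comm v (g (o i))] at h3
    linarith [hi.1, hi.2]
  -- Exponential Markov inequality: failure forces `4 ^ R ≤ 16 ^ #bad`, and a single factor has mean
  -- (1 + 15 η)/4, which is at most 1/2 for η ≤ 1/16.
  have hpt : ∀ o : Fin R → O,
      (if 2 * lam < |pick o - f A B| then ∏ i, D A B (o i) else 0) ≤ ∏ i, D A B (o i) * (if bad (o i) then 16 else 1) / 4 := by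
    intro o
    have hnn : ∀ i, 0 ≤ D A B (o i) := fun i => hD.nonneg A B _
    by_cases h1 : 2 * lam < |pick o - f A B|
    · have h2 := key o h1
      rw [if_pos h1, Finset.prod_div_distrib, Finset.prod_mul_distrib, Finset.prod_ite, Finset.prod_const,
        Finset.prod_const, Finset.prod_const, one_pow, mul_one, Finset.card_univ, Fintype.card_fin,
        le_div_iff₀ (by positivity)]
      refine mul_le_mul_of_nonneg_left ?_ (Finset.prod_nonneg fun i _ => hnn i)
      calc (4 : ℝ) ^ R ≤ 4 ^ (2 * (Finset.univ.filter fun i => bad (o i)).card) :=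
            pow_le_pow_right₀ (by norm_num) h2
        _ = 16 ^ (Finset.univ.filter fun i => bad (o i)).card := by rw [pow_mul]; norm_num
    · rw [if_neg h1]
      refine Finset.prod_nonneg fun i _ => ?_
      have := hnn i
      split_ifs <;> positivity
  refine (Finset.sum_le_sum fun o _ => hpt o).trans ?_
  have hprod := Finset.prod_univ_sum (fun _ : Fin R => (Finset.univ : Finset O))
    fun _ o => D A B o * (if bad o then 16 else 1) / 4
  rw [Fintype.piFinset_univ] at hprod
  rw [← hprod, Finset.prod_const, Finset.card_univ, Fintype.card_fin]
  have hsum : ∑ o, D A B o * (if bad o then 16 else 1) / 4 =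
      (1 + 15 * ∑ o, if bad o then D A B o else 0) / 4 := by
    conv_rhs => rw [← hD.sum_eq_one A B]
    rw [Finset.mul_sum, ← Finset.sum_add_distrib, Finset.sum_div]
    refine Finset.sum_congr rfl fun o _ => ?_
    split_ifs <;> ring
  refine pow_le_pow_left₀ (Finset.sum_nonneg fun o _ => ?_) ?_ R
  · have := hD.nonneg A B o
    split_ifs <;> positivity
  · rw [hsum]
    have := h A B
    linarith

theorem exists_offset {m : ℕ} (hm : 0 < m) {e u : ℝ} (he : 0 < e) (hu : |u| ≤ m * e) :
    ∃ j : Fin m, |(2 * (j : ℝ) + 1 - m) * e - u| ≤ e := by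
  have hm' : (1 : ℝ) ≤ m := by exact_mod_cast hm
  have h1 := abs_le.1 hu
  set x := (u / e + m) / 2 with hx
  have hxu : u = (2 * x - m) * e := by rw [hx]; field_simp; ring
  have hx0 : 0 ≤ x := by
    by_contra! h; nlinarith
  have hxm : x ≤ m := by
    by_contra! h; nlinarith
  have main : ∃ j : ℕ, j < m ∧ (j : ℝ) ≤ x ∧ x ≤ j + 1 := by
    rcases lt_or_ge x m with h | h
    -- The floor fails only at the right end `x = m`, where the last interval is taken.
    · exact ⟨⌊x⌋₊, (Nat.floor_lt hx0).2 h, Nat.floor_le hx0, (Nat.lt_floor_add_one x).le⟩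
    · refine ⟨m - 1, by omega, ?_, ?_⟩ <;> rw [Nat.cast_sub hm] <;> push_cast <;> linarith
  obtain ⟨j, hj, h2, h3⟩ := main
  refine ⟨⟨j, hj⟩, ?_⟩
  rw [hxu, show (2 * (j : ℝ) + 1 - m) * e - (2 * x - m) * e = (2 * (j - x) + 1) * e by ring,
    abs_mul, abs_of_pos he]
  have h4 : |2 * ((j : ℝ) - x) + 1| ≤ 1 := abs_le.2 ⟨by linarith, by linarith⟩
  nlinarith

/-- The offsets `(2 j + 1 - m) * e` are the centres of `m` intervals of length `2 * e` that cover
`[-m e, m e]`; a random one repairs a coarse estimate with probability at least 1/m. -/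
theorem EstimatesWithin.guess [Nonempty S] [Nonempty T] {e : ℝ} (he : 0 < e) {m : ℕ} (hm : 0 < m)
    (h : EstimatesWithin k η (m * e) f) : EstimatesWithin k (1 - (1 - η) / m) e f := by
  have : NeZero m := ⟨hm.ne'⟩
  have hm' : (0 : ℝ) < m := by exact_mod_cast hm
  obtain ⟨O, _, _, D, g, hD, h⟩ := h
  refine ⟨O × Fin m, inferInstance, inferInstance, _,
    fun o => g o.1 + (2 * (o.2 : ℝ) + 1 - m) * e, hD.prod (Realizable.uniform m), fun A B => ?_⟩
  rw [Fintype.sum_prod_type]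
  calc _ ≤ ∑ o, (D A B o * (1 - (m : ℝ)⁻¹) + (m : ℝ)⁻¹ * if m * e < |g o - f A B| then D A B o else 0) := by
        refine Finset.sum_le_sum fun o _ => ?_
        have h0 := hD.nonneg A B o
        have h1 : ∀ j : Fin m, 0 ≤ D A B o * (m : ℝ)⁻¹ := fun j => by positivity
        have hall : ∑ _j : Fin m, D A B o * (m : ℝ)⁻¹ = D A B o := by
          rw [Finset.sum_const, Finset.card_univ, Fintype.card_fin, nsmul_eq_mul]
          field_simp
        by_cases hb : m * e < |g o - f A B|
        · rw [if_pos hb, show D A B o * (1 - (m : ℝ)⁻¹) + (m : ℝ)⁻¹ * D A B o = D A B o by ring]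
          refine le_of_le_of_eq ?_ hall
          refine Finset.sum_le_sum fun j _ => ?_
          split_ifs
          · rfl
          · exact h1 j
        · rw [if_neg hb, mul_zero, add_zero, mul_sub, mul_one]
          obtain ⟨j, hj⟩ := exists_offset hm he
            (show |f A B - g o| ≤ m * e by rw [abs_sub_comm]; exact not_lt.1 hb)
          rw [← Finset.add_sum_erase _ _ (Finset.mem_univ j), if_neg, zero_add]
          · rw [le_sub_iff_add_le]
            conv_rhs => rw [← hall, ← Finset.add_sum_erase _ _ (Finset.mem_univ j), add_comm]
            gcongr with i _
            split_ifs
            · rfl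
            · exact h1 i
          · rw [not_lt]
            refine le_of_eq_of_le (congrArg abs ?_) hj
            ring
    _ = 1 - (m : ℝ)⁻¹ + (m : ℝ)⁻¹ * ∑ o, if m * e < |g o - f A B| then D A B o else 0 := by
        rw [Finset.sum_add_distrib, ← Finset.sum_mul, hD.sum_eq_one, one_mul, Finset.mul_sum]
    _ ≤ 1 - (m : ℝ)⁻¹ + (m : ℝ)⁻¹ * η := by gcongr; exact h A B
    _ = _ := by ring

theorem EstimatesWithin.exists_qAlgorithm (h : EstimatesWithin k η lam f) :
    ∃ 𝒜 : QAlgorithm S T, 𝒜.numSamples = k ∧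
      ∀ A B, 1 - η ≤ 𝒜.outputProb A B {e | |e - f A B| ≤ lam} := by
  obtain ⟨O, _, _, D, g, hD, h⟩ := h
  obtain ⟨𝒜, h1, h2⟩ := exists_qAlgorithm_of_realizable hD g
  refine ⟨𝒜, h1, fun A B => ?_⟩
  rw [h2, sub_le_iff_le_add, ← hD.sum_eq_one A B]
  refine le_trans (le_of_eq ?_) (add_le_add_right (h A B) _)
  rw [← Finset.sum_add_distrib]
  refine Finset.sum_congr rfl fun o _ => ?_
  by_cases ho : lam < |g o - f A B|
  · rw [if_pos ho, Set.indicator_of_notMem (by simpa using ho), zero_add]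
  · rw [if_neg ho, Set.indicator_of_mem (by simpa using ho), add_zero]

end EstimatesWithin

/-! ### The sampled distribution in terms of the unitary. -/

section OutDist

variable {S T : Type*} [Fintype S] [DecidableEq S] [Fintype T] [DecidableEq T] {n : ℕ}

/-- The distribution that a unitary samples from. -/
noncomputable def outDist (A : Matrix.unitaryGroup S ℂ) (s₀ : S) (φ : S → Fin n) (x : Fin n) : ℝ :=
  nrmSq (restrictTo (fun s => φ s = x) (col A s₀))

theorem nrmSq_restrictTo {X : Type*} [Fintype X] (good : X → Prop) [DecidablePred good]
    (v : X → ℂ) : nrmSq (restrictTo good v) = ∑ x, if good x then ‖v x‖ ^ 2 else 0 := by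
  refine Finset.sum_congr rfl fun x _ => ?_
  by_cases h : good x <;> simp [restrictTo, h]

theorem SamplesFrom.eq_outDist {A : Matrix.unitaryGroup S ℂ} {s₀ : S} {φ : S → Fin n}
    {p : Fin n → ℝ} (h : SamplesFrom A s₀ φ p) : p = outDist A s₀ φ := by
  funext x
  rw [h x, outDist, nrmSq_restrictTo, Finset.sum_filter]
  simp only [col_apply]

variable (A : Matrix.unitaryGroup S ℂ) (s₀ : S) (φ : S → Fin n)

theorem outDist_nonneg (x : Fin n) : 0 ≤ outDist A s₀ φ x := nrmSq_nonneg _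

theorem outDist_le_one (x : Fin n) : outDist A s₀ φ x ≤ 1 := nrmSq_restrictTo_col_le_one _ _ _

theorem sum_outDist : ∑ x, outDist A s₀ φ x = 1 := by
  simp only [outDist, nrmSq_restrictTo]
  rw [Finset.sum_comm, ← nrmSq_col A s₀]
  simp [nrmSq]

end OutDist

/-! ### Outcome statistics of the sampling circuit, and the outer amplitude estimation. -/

section Joint

variable {S T : Type*} [Fintype S] [DecidableEq S] [Fintype T] [DecidableEq T] {n : ℕ}
  {C C' : Type} [Fintype C] [DecidableEq C] [Fintype C'] [DecidableEq C']

/-- The probability that the sampling circuit records `x` and that phase estimation with the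
clock `κ` on the two registers has the outcomes `y` and `y'`. -/
noncomputable def joint (κ : Clock C) (s₀ : S) (t₀ : T) (φ : S → Fin n) (ψ : T → Fin n)
    (A : Matrix.unitaryGroup S ℂ) (B : Matrix.unitaryGroup T ℂ) (x : Fin n) (y y' : C) : ℝ :=
  (∑ c, nrmSq (κ.branch (groverAt A s₀ φ x) (sampledState A s₀ φ c x) y)) *
    nrmSq (κ.branch (groverAt B t₀ ψ x) (col B t₀) y')

/-- The expectation of a function of the outcomes. -/
noncomputable def jointMean (κ : Clock C) (s₀ : S) (t₀ : T) (φ : S → Fin n) (ψ : T → Fin n)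
    (f : C → C → ℝ) (A : Matrix.unitaryGroup S ℂ) (B : Matrix.unitaryGroup T ℂ) : ℝ :=
  ∑ x, ∑ y, ∑ y', joint κ s₀ t₀ φ ψ A B x y y' * f y y'

variable (κ : Clock C) (κ' : Clock C') (s₀ : S) (t₀ : T) (φ : S → Fin n) (ψ : T → Fin n)
  (A : Matrix.unitaryGroup S ℂ) (B : Matrix.unitaryGroup T ℂ)

theorem joint_nonneg (x : Fin n) (y y' : C) : 0 ≤ joint κ s₀ t₀ φ ψ A B x y y' :=
  mul_nonneg (Finset.sum_nonneg fun _ _ => nrmSq_nonneg _) (nrmSq_nonneg _)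

theorem nrmSq_real_smul {X : Type*} [Fintype X] (c : ℝ) (v : X → ℂ) :
    nrmSq (c • v) = c ^ 2 * nrmSq v := by
  simp [nrmSq, Finset.mul_sum, mul_pow]

theorem sum_nrmSq_sampledState (x : Fin n) :
    ∑ c, nrmSq (sampledState A s₀ φ c x) = (outDist A s₀ φ x + (n : ℝ)⁻¹) / 2 := by
  simp only [sampledState, Fintype.sum_bool, if_true, Bool.false_eq_true, if_false,
    nrmSq_real_smul, nrmSq_col, inv_pow]
  rw [Real.sq_sqrt (by norm_num), Real.sq_sqrt (by positivity), mul_inv]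
  simp only [outDist]
  ring

theorem sum_joint (x : Fin n) :
    ∑ y, ∑ y', joint κ s₀ t₀ φ ψ A B x y y' = (outDist A s₀ φ x + (n : ℝ)⁻¹) / 2 := by
  simp only [joint, ← Finset.mul_sum, Clock.sum_nrmSq_branch, nrmSq_col, mul_one]
  rw [Finset.sum_comm]
  simp only [Clock.sum_nrmSq_branch, sum_nrmSq_sampledState]

theorem rotatesBy_sampledState (c : Bool) (x : Fin n) :
    RotatesBy (groverAt A s₀ φ x) (outDist A s₀ φ x) (sampledState A s₀ φ c x) := by
  cases c
  · simp only [sampledState, Bool.false_eq_true, if_false]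
    exact (rotatesBy_grover_col A s₀ fun s => φ s = x).smul (((√(2 * n : ℝ))⁻¹ : ℝ) : ℂ)
  · simp only [sampledState, if_true]
    exact (rotatesBy_grover_restrictTo A s₀ fun s => φ s = x).smul (((√2)⁻¹ : ℝ) : ℂ)

theorem sum_joint_fst (m : ℕ) (hm : 0 < m) (x : Fin n) :
    ∑ y, ∑ y', joint (phaseClock m hm) s₀ t₀ φ ψ A B x y y' *
      (rootEst m y - √(outDist A s₀ φ x)) ^ 4 ≤
      2187 / (m : ℝ) ^ 4 * ((outDist A s₀ φ x + (n : ℝ)⁻¹) / 2) := by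
  simp only [joint, ← Finset.mul_sum, ← Finset.sum_mul, Clock.sum_nrmSq_branch, nrmSq_col, mul_one]
  simp only [Finset.sum_mul]
  rw [Finset.sum_comm, ← sum_nrmSq_sampledState, Finset.mul_sum]
  refine Finset.sum_le_sum fun c _ => ?_
  simpa only [mul_comm] using (rotatesBy_sampledState s₀ φ A c x).sum_pow_four_mul_nrmSq_branch_le
    (outDist_nonneg _ _ _ _) (outDist_le_one _ _ _ _) m hm

theorem sum_joint_snd (m : ℕ) (hm : 0 < m) (x : Fin n) :
    ∑ y, ∑ y', joint (phaseClock m hm) s₀ t₀ φ ψ A B x y y' *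
      (rootEst m y' - √(outDist B t₀ ψ x)) ^ 4 ≤
      2187 / (m : ℝ) ^ 4 * ((outDist A s₀ φ x + (n : ℝ)⁻¹) / 2) := by
  simp only [joint, mul_assoc, ← Finset.mul_sum, ← Finset.sum_mul]
  rw [Finset.sum_comm]
  simp only [Clock.sum_nrmSq_branch, sum_nrmSq_sampledState]
  rw [mul_comm]
  have hp := outDist_nonneg A s₀ φ x
  refine mul_le_mul_of_nonneg_right ?_ (by positivity)
  have h := (rotatesBy_grover_col B t₀ fun t => ψ t = x).sum_pow_four_mul_nrmSq_branch_le
    (outDist_nonneg B t₀ ψ x) (outDist_le_one B t₀ ψ x) m hm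
  rw [nrmSq_col, mul_one] at h
  exact le_of_eq_of_le (Finset.sum_congr rfl fun _ _ => mul_comm _ _) h

/-- Branching by the second clock preserves the norm, so summing out its outcomes leaves the
statistics of the first clock alone. -/
theorem sum_joint_prod_fst (f : C → C → ℝ) (x : Fin n) :
    ∑ y, ∑ y', joint (κ.prod κ') s₀ t₀ φ ψ A B x y y' * f y.1 y'.1 =
      ∑ y, ∑ y', joint κ s₀ t₀ φ ψ A B x y y' * f y y' := by
  simp only [joint, Fintype.sum_prod_type, Clock.prod_branch']
  refine Finset.sum_congr rfl fun y _ => ?_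
  rw [Finset.sum_comm]
  refine Finset.sum_congr rfl fun y' _ => ?_
  simp only [← Finset.sum_mul, ← Finset.mul_sum, Clock.sum_nrmSq_branch]
  rw [Finset.sum_comm]
  simp only [Clock.sum_nrmSq_branch]

theorem sum_joint_prod_snd (f : C' → C' → ℝ) (x : Fin n) :
    ∑ y, ∑ y', joint (κ.prod κ') s₀ t₀ φ ψ A B x y y' * f y.2 y'.2 =
      ∑ y, ∑ y', joint κ' s₀ t₀ φ ψ A B x y y' * f y y' := by
  simp only [joint, Fintype.sum_prod_type_right, Clock.prod_branch]
  refine Finset.sum_congr rfl fun y _ => ?_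
  rw [Finset.sum_comm]
  refine Finset.sum_congr rfl fun y' _ => ?_
  simp only [← Finset.sum_mul, ← Finset.mul_sum, Clock.sum_nrmSq_branch]
  rw [Finset.sum_comm]
  simp only [Clock.sum_nrmSq_branch]

theorem sum_outDist_add_inv_div_two : ∑ x, (outDist A s₀ φ x + (n : ℝ)⁻¹) / 2 = 1 := by
  have hn : (n : ℝ) ≠ 0 := by have := (φ s₀).pos; exact_mod_cast this.ne'
  rw [← Finset.sum_div, Finset.sum_add_distrib, sum_outDist, Finset.sum_const, Finset.card_univ,
    Fintype.card_fin, nsmul_eq_mul, mul_inv_cancel₀ hn]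
  norm_num

/-- A uniform `j : Fin L` turns a value `v` into the event `j < L * v`, whose probability is ⌈L
v⌉/L. -/
theorem abs_card_div_sub_le {L : ℕ} (hL : 0 < L) {v : ℝ} (h0 : 0 ≤ v) (h1 : v ≤ 1) :
    |(∑ j : Fin L, if (j : ℝ) < L * v then (L : ℝ)⁻¹ else 0) - v| ≤ (L : ℝ)⁻¹ := by
  have hL' : (0 : ℝ) < L := by exact_mod_cast hL
  have hc : ⌈L * v⌉₊ ≤ L := Nat.ceil_le.2 (by nlinarith)
  have hs : (∑ j : Fin L, if (j : ℝ) < L * v then (L : ℝ)⁻¹ else 0) = ⌈L * v⌉₊ * (L : ℝ)⁻¹ := by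
    rw [Fin.sum_univ_eq_sum_range (fun j => if (j : ℝ) < L * v then (L : ℝ)⁻¹ else 0),
      ← Finset.sum_filter, Finset.sum_const, nsmul_eq_mul]
    congr 2
    rw [← Finset.card_range ⌈L * v⌉₊]
    congr 1
    ext j
    simp only [Finset.mem_filter, Finset.mem_range, Nat.lt_ceil]
    refine ⟨fun h => h.2, fun h => ⟨?_, h⟩⟩
    exact (Nat.lt_ceil.2 h).trans_le hc
  have h2 := Nat.le_ceil (L * v)
  have h3 := Nat.ceil_lt_add_one (a := L * v) (by positivity)
  have h4 : (⌈L * v⌉₊ : ℝ) * (L : ℝ)⁻¹ - v = (⌈L * v⌉₊ - L * v) * (L : ℝ)⁻¹ := by field_simp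
  rw [hs, h4, abs_mul, abs_of_pos (inv_pos.2 hL'), abs_of_nonneg (by linarith)]
  exact mul_le_of_le_one_left (by positivity) (by linarith)

/-- Sorting the registers of the sampling circuit. -/
def sortEquiv (S T P X C L : Type*) : (X × C × C) × (P × S × T × L) ≃ S × T × ((P × X) × (C × C) × L) where
  toFun a := (a.2.2.1, a.2.2.2.1, ((a.2.1, a.1.1), (a.1.2.1, a.1.2.2), a.2.2.2.2))
  invFun a := ((a.2.2.1.2, a.2.2.2.1.1, a.2.2.2.1.2), (a.2.2.1.1, a.1, a.2.1, a.2.2.2.2))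
  left_inv _ := rfl
  right_inv _ := rfl

-- With the outcomes `j < L * f y y'` marked as good, the mean of `f` becomes, up to 1/L, the
-- probability of the good states of a single circuit, to which amplitude estimation applies.
set_option synthInstance.maxSize 1000 in
theorem estimatesWithin_jointMean [Nonempty C] (N : ℕ) (hN : ∀ t, κ.time t ≤ N) (f : C → C → ℝ)
    (hf0 : ∀ y y', 0 ≤ f y y') (hf1 : ∀ y y', f y y' ≤ 1) {lam : ℝ} (hlam : 0 < lam) {m : ℕ}
    (hm : 72 ≤ m * lam) :
    EstimatesWithin ((2 + 4 * N) * (8 * m + 3)) (1 / 48) lam (jointMean κ s₀ t₀ φ ψ f) := by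
  have hm0 : 0 < m := by
    rcases Nat.eq_zero_or_pos m with rfl | h
    · norm_num at hm
    · exact h
  have hm' : (0 : ℝ) < m := by exact_mod_cast hm0
  -- `L` enters the size of the workspace but not the number of uses, so it may be as large as
  -- needed.
  obtain ⟨L, hL⟩ := exists_nat_ge (2 / lam)
  have hL' : (0 : ℝ) < L := lt_of_lt_of_le (by positivity) hL
  have hL0 : 0 < L := by exact_mod_cast hL'
  have : NeZero L := ⟨hL0.ne'⟩
  have hLi : (L : ℝ)⁻¹ ≤ lam / 2 := by
    rw [inv_le_comm₀ hL' (by positivity)]; simpa using hL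
  obtain ⟨b₀, F, hF, hcol⟩ := exists_sampling_circuit (L := L) s₀ t₀ φ ψ κ N hN
  let good : S × T × ((Bool × Fin n) × (C × C) × Fin L) → Prop := fun b =>
    (b.2.2.2.2 : ℝ) < L * f b.2.2.2.1.1 b.2.2.2.1.2
  have hreal := hF.realizable_amplitude_estimation b₀ good (phaseClock m hm0) (4 * m + 1)
    (fun t => by simp only [phaseClock]; omega)
  rw [show 2 * (4 * m + 1) + 1 = 8 * m + 3 by ring] at hreal
  refine ⟨_, inferInstance, inferInstance, _, fun y => rootEst m y ^ 2, hreal, fun A B => ?_⟩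
  set a := nrmSq (restrictTo good (col (F A B) b₀)) with ha
  have haE : |a - jointMean κ s₀ t₀ φ ψ f A B| ≤ lam / 2 := by
    have h1 : a = ∑ x, ∑ y, ∑ y', joint κ s₀ t₀ φ ψ A B x y y' *
        ∑ j : Fin L, if (j : ℝ) < L * f y y' then (L : ℝ)⁻¹ else 0 := by
      rw [ha, nrmSq_restrictTo, ← (sortEquiv S T Bool (Fin n) C (Fin L)).sum_comp,
        Fintype.sum_prod_type, Fintype.sum_prod_type]
      simp only [Fintype.sum_prod_type (fun x : C × C => _)]
      refine Finset.sum_congr rfl fun x _ => Finset.sum_congr rfl fun y _ =>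
        Finset.sum_congr rfl fun y' _ => ?_
      rw [Fintype.sum_prod_type, joint, Finset.sum_mul, Finset.sum_mul]
      refine Finset.sum_congr rfl fun c _ => ?_
      rw [Fintype.sum_prod_type, nrmSq, Finset.sum_mul, Finset.sum_mul]
      refine Finset.sum_congr rfl fun s _ => ?_
      rw [Fintype.sum_prod_type, nrmSq, mul_assoc, Finset.sum_mul, Finset.mul_sum]
      refine Finset.sum_congr rfl fun t _ => ?_
      rw [Finset.mul_sum, Finset.mul_sum]
      refine Finset.sum_congr rfl fun j _ => ?_
      simp only [sortEquiv, Equiv.coe_fn_mk, good, hcol]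
      split_ifs
      · rw [norm_mul, norm_mul, Complex.norm_real, Real.norm_eq_abs, mul_pow, mul_pow, sq_abs,
          inv_pow, Real.sq_sqrt hL'.le]
        ring
      · simp
    have h2 := sum_outDist_add_inv_div_two s₀ φ A
    rw [h1, jointMean]
    simp only [← Finset.sum_sub_distrib, ← mul_sub]
    calc _ ≤ ∑ x, ∑ y, ∑ y', joint κ s₀ t₀ φ ψ A B x y y' * (L : ℝ)⁻¹ := by
          refine (Finset.abs_sum_le_sum_abs _ _).trans (Finset.sum_le_sum fun x _ => ?_)
          refine (Finset.abs_sum_le_sum_abs _ _).trans (Finset.sum_le_sum fun y _ => ?_)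
          refine (Finset.abs_sum_le_sum_abs _ _).trans (Finset.sum_le_sum fun y' _ => ?_)
          have h3 := joint_nonneg κ s₀ t₀ φ ψ A B x y y'
          rw [abs_mul, abs_of_nonneg h3]
          exact mul_le_mul_of_nonneg_left (abs_card_div_sub_le hL0 (hf0 _ _) (hf1 _ _)) h3
      _ = (L : ℝ)⁻¹ := by
          simp only [← Finset.sum_mul, sum_joint, h2, one_mul]
      _ ≤ _ := hLi
  have ha0 : 0 ≤ a := nrmSq_nonneg _
  have ha1 : a ≤ 1 := nrmSq_restrictTo_col_le_one _ _ _
  have hmom := (rotatesBy_grover_col (F A B) b₀ good).sum_pow_four_mul_nrmSq_branch_le ha0 ha1 m hm0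
  rw [nrmSq_col, mul_one] at hmom
  -- Markov with the fourth moment: half of `lam` is spent on 1/L, and |e² - a| ≤ 2 |e - √a| for the
  -- root estimate e, so a failure has |e - √a| ≥ lam/4.
  calc _ ≤ ∑ y, (4 / lam) ^ 4 * ((rootEst m y - √a) ^ 4 * nrmSq ((phaseClock m hm0).branch
        (grover (F A B) b₀ good) (col (F A B) b₀) y)) := by
        refine Finset.sum_le_sum fun y _ => ?_
        have hD := nrmSq_nonneg ((phaseClock m hm0).branch (grover (F A B) b₀ good)
          (col (F A B) b₀) y)
        split_ifs with h
        · have h1 := abs_sub_le (rootEst m y ^ 2) a (jointMean κ s₀ t₀ φ ψ f A B)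
          have h2 : |rootEst m y ^ 2 - a| ≤ 2 * |rootEst m y - √a| := by
            have h3 : rootEst m y ^ 2 - a = (rootEst m y + √a) * (rootEst m y - √a) := by
              rw [← sq_sub_sq, Real.sq_sqrt ha0]
            have h4 : √a ≤ 1 := Real.sqrt_le_one.2 ha1
            have h5 := rootEst_le_one m y
            have h6 := rootEst_nonneg m y
            rw [h3, abs_mul, abs_of_nonneg (by positivity)]
            gcongr
            linarith
          have h7 : lam / 4 ≤ |rootEst m y - √a| := by linarith
          have h8 : (lam / 4) ^ 4 ≤ (rootEst m y - √a) ^ 4 := by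
            rw [← Even.pow_abs (show Even 4 by decide) (rootEst m y - √a)]
            gcongr
          have h9 : 1 ≤ (4 / lam) ^ 4 * (rootEst m y - √a) ^ 4 := by
            calc (1 : ℝ) = (4 / lam) ^ 4 * (lam / 4) ^ 4 := by field_simp
              _ ≤ _ := by gcongr
          rw [← mul_assoc]
          exact le_mul_of_one_le_left hD h9
        · have : 0 ≤ (rootEst m y - √a) ^ 4 := by positivity
          positivity
    _ ≤ (4 / lam) ^ 4 * (2187 / (m : ℝ) ^ 4) := by
        rw [← Finset.mul_sum]; gcongr
    _ = 72 ^ 4 / (m * lam) ^ 4 * (1 / 48) := by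
        rw [mul_pow]; field_simp; norm_num
    _ ≤ 1 * (1 / 48) := by
        gcongr
        rw [div_le_one (by positivity)]
        gcongr
    _ = _ := one_mul _

end Joint

/-! ### The gain is Lipschitz in the square roots; clipping. -/

section Gain

/-- The contribution to the total variation distance, relative to the weight `(a ^ 2 + n⁻¹) / 2`, of
an element with probabilities `a ^ 2` and `b ^ 2`. -/
noncomputable def gain (n : ℕ) (a b : ℝ) : ℝ := 2 * (max (a ^ 2 - b ^ 2) 0 / (a ^ 2 + (n : ℝ)⁻¹))

theorem gain_nonneg (n : ℕ) (a b : ℝ) : 0 ≤ gain n a b := by unfold gain; positivity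

theorem gain_le_two {n : ℕ} (hn : 0 < n) (a b : ℝ) : gain n a b ≤ 2 := by
  have hn' : (0 : ℝ) < (n : ℝ)⁻¹ := by positivity
  have : max (a ^ 2 - b ^ 2) 0 / (a ^ 2 + (n : ℝ)⁻¹) ≤ 1 := by
    rw [div_le_one (by positivity)]
    exact max_le (by nlinarith [sq_nonneg b]) (by positivity)
  unfold gain
  linarith

/-- Arithmetic-geometric mean: the difference is (√n t - 1)²/√n. -/
theorem two_mul_le_sqrt_mul {n : ℕ} (hn : 0 < n) (t : ℝ) : 2 * t ≤ √n * (t ^ 2 + (n : ℝ)⁻¹) := by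
  have hn' : (0 : ℝ) < n := by exact_mod_cast hn
  have hs : 0 < √(n : ℝ) := Real.sqrt_pos.2 hn'
  have h1 : √(n : ℝ) * (n : ℝ)⁻¹ = (√(n : ℝ))⁻¹ := by
    conv_lhs => rw [← Real.mul_self_sqrt hn'.le, Real.sqrt_mul_self hs.le]
    field_simp
  have h2 : √(n : ℝ) * (t ^ 2 + (n : ℝ)⁻¹) - 2 * t = (√n * t - 1) ^ 2 / √n := by
    rw [mul_add, h1]; field_simp; ring
  have h3 : 0 ≤ (√n * t - 1) ^ 2 / √(n : ℝ) := by positivity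
  linarith

/-- As b grows, the numerator falls by at most 2a per unit, because it vanishes once b exceeds a;
dividing by a² + 1/n leaves a slope of at most √n, before the factor 2. -/
theorem gain_sub_gain_right_le {n : ℕ} (hn : 0 < n) {a b b' : ℝ} (ha : 0 ≤ a) (hb : 0 ≤ b)
    (h : b ≤ b') : gain n a b - gain n a b' ≤ 2 * √n * (b' - b) := by
  have hn' : (0 : ℝ) < (n : ℝ)⁻¹ := by positivity
  have hd : 0 < a ^ 2 + (n : ℝ)⁻¹ := by positivity
  have h1 : max (a ^ 2 - b ^ 2) 0 - max (a ^ 2 - b' ^ 2) 0 ≤ 2 * a * (b' - b) := by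
    rcases le_total a b with h2 | h2
    · rw [max_eq_right (by nlinarith)]
      have := le_max_right (a ^ 2 - b' ^ 2) 0
      have : 0 ≤ 2 * a * (b' - b) := mul_nonneg (by linarith) (by linarith)
      linarith
    · rw [max_eq_left (by nlinarith)]
      rcases le_total a b' with h3 | h3
      · have := le_max_right (a ^ 2 - b' ^ 2) 0
        nlinarith
      · have := le_max_left (a ^ 2 - b' ^ 2) 0
        nlinarith
  unfold gain
  rw [← mul_sub, ← sub_div, mul_assoc]
  refine mul_le_mul_of_nonneg_left ?_ zero_le_two
  rw [div_le_iff₀ hd]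
  refine h1.trans ?_
  nlinarith [mul_le_mul_of_nonneg_right (two_mul_le_sqrt_mul hn a) (sub_nonneg.2 h)]

/-- The growth of the denominator only lowers the gain, so the growth of the numerator alone bounds
the increase. -/
theorem gain_sub_gain_left_le {n : ℕ} (hn : 0 < n) {a a' b : ℝ} (ha : 0 ≤ a) (h : a ≤ a') :
    gain n a' b - gain n a b ≤ 2 * √n * (a' - a) := by
  have hn' : (0 : ℝ) < (n : ℝ)⁻¹ := by positivity
  have hd : 0 < a' ^ 2 + (n : ℝ)⁻¹ := by positivity
  have h1 : max (a' ^ 2 - b ^ 2) 0 - max (a ^ 2 - b ^ 2) 0 ≤ 2 * a' * (a' - a) := by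
    have h2 := le_max_left (a ^ 2 - b ^ 2) 0
    have h3 := le_max_right (a ^ 2 - b ^ 2) 0
    rcases max_cases (a' ^ 2 - b ^ 2) 0 with ⟨h4, -⟩ | ⟨h4, -⟩ <;> rw [h4] <;> nlinarith
  have h5 : max (a ^ 2 - b ^ 2) 0 / (a' ^ 2 + (n : ℝ)⁻¹) ≤
      max (a ^ 2 - b ^ 2) 0 / (a ^ 2 + (n : ℝ)⁻¹) := by gcongr
  have h6 : max (a' ^ 2 - b ^ 2) 0 / (a' ^ 2 + (n : ℝ)⁻¹) -
      max (a ^ 2 - b ^ 2) 0 / (a' ^ 2 + (n : ℝ)⁻¹) ≤ √n * (a' - a) := by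
    rw [← sub_div, div_le_iff₀ hd]
    refine h1.trans ?_
    nlinarith [mul_le_mul_of_nonneg_right (two_mul_le_sqrt_mul hn a') (sub_nonneg.2 h)]
  unfold gain
  linarith

theorem gain_anti {n : ℕ} {a b b' : ℝ} (hb : 0 ≤ b) (h : b ≤ b') : gain n a b' ≤ gain n a b := by
  unfold gain
  gcongr

theorem gain_mono {n : ℕ} (hn : 0 < n) {a a' b : ℝ} (ha : 0 ≤ a) (h : a ≤ a') :
    gain n a b ≤ gain n a' b := by
  have hn' : (0 : ℝ) < (n : ℝ)⁻¹ := by positivity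
  unfold gain
  refine mul_le_mul_of_nonneg_left ?_ zero_le_two
  have hsq : a ^ 2 ≤ a' ^ 2 := by gcongr
  rcases le_total (a ^ 2) (b ^ 2) with h1 | h1
  · rw [max_eq_right (by linarith), zero_div]; positivity
  · rw [max_eq_left (by linarith), max_eq_left (by linarith), div_le_div_iff₀ (by positivity)
      (by positivity)]
    nlinarith [mul_nonneg (sub_nonneg.2 hsq) (add_nonneg (sq_nonneg b) hn'.le)]

theorem abs_gain_sub_gain_le {n : ℕ} (hn : 0 < n) {a a' b b' : ℝ} (ha : 0 ≤ a) (ha' : 0 ≤ a')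
    (hb : 0 ≤ b) (hb' : 0 ≤ b') :
    |gain n a b - gain n a' b'| ≤ 2 * √n * (|a - a'| + |b - b'|) := by
  have h1 : |gain n a b - gain n a' b| ≤ 2 * √n * |a - a'| := by
    rcases le_total a a' with h | h
    · rw [abs_of_nonpos (sub_nonpos.2 (gain_mono hn ha h)), abs_of_nonpos (sub_nonpos.2 h)]
      simpa using gain_sub_gain_left_le hn ha h
    · rw [abs_of_nonneg (sub_nonneg.2 (gain_mono hn ha' h)), abs_of_nonneg (sub_nonneg.2 h)]
      exact gain_sub_gain_left_le hn ha' h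
  have h2 : |gain n a' b - gain n a' b'| ≤ 2 * √n * |b - b'| := by
    rcases le_total b b' with h | h
    · rw [abs_of_nonneg (sub_nonneg.2 (gain_anti hb h)), abs_of_nonpos (sub_nonpos.2 h)]
      simpa using gain_sub_gain_right_le hn ha' hb h
    · rw [abs_of_nonpos (sub_nonpos.2 (gain_anti hb' h)), abs_of_nonneg (sub_nonneg.2 h)]
      simpa using gain_sub_gain_right_le hn ha' hb' h
  calc _ ≤ _ := abs_sub_le _ (gain n a' b) _
    _ ≤ _ := add_le_add h1 h2
    _ = _ := by ring

theorem abs_le_add_pow_four_div (d : ℝ) {κ : ℝ} (hκ : 0 < κ) : |d| ≤ κ + d ^ 4 / κ ^ 3 := by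
  rcases le_total |d| κ with h | h
  · have : 0 ≤ d ^ 4 / κ ^ 3 := by positivity
    linarith
  · have : |d| ≤ d ^ 4 / κ ^ 3 := by
      rw [le_div_iff₀ (by positivity), ← Even.pow_abs (show Even 4 by decide) d, pow_succ' |d| 3]
      gcongr
    linarith

/-- Truncation to the interval `[-κ, κ]`. -/
noncomputable def clip (κ d : ℝ) : ℝ := max (-κ) (min d κ)

theorem neg_le_clip (κ d : ℝ) : -κ ≤ clip κ d := le_max_left _ _

theorem clip_le {κ : ℝ} (hκ : 0 ≤ κ) (d : ℝ) : clip κ d ≤ κ :=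
  max_le (by linarith) (min_le_right _ _)

/-- Clipping matters only for `|d| > κ`. Second moments would give only d²/κ, which at κ = ε^{1/3}
is too weak for the levels used below. -/
theorem abs_clip_sub_le (d : ℝ) {κ : ℝ} (hκ : 0 < κ) : |clip κ d - d| ≤ d ^ 4 / κ ^ 3 := by
  have h0 : 0 ≤ d ^ 4 / κ ^ 3 := by positivity
  rcases le_total |d| κ with h | h
  · have h1 := abs_le.1 h
    rw [clip, min_eq_left h1.2, max_eq_right h1.1, sub_self, abs_zero]
    exact h0
  · have h2 : |d| ≤ d ^ 4 / κ ^ 3 := by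
      rw [le_div_iff₀ (by positivity), ← Even.pow_abs (show Even 4 by decide) d, pow_succ' |d| 3]
      gcongr
    refine le_trans ?_ h2
    rcases le_abs.1 h with h3 | h3
    · rw [clip, min_eq_right h3, max_eq_right (by linarith), abs_of_nonpos (by linarith),
        abs_of_pos (by linarith)]
      linarith
    · rw [clip, min_eq_left (by linarith), max_eq_left (by linarith), abs_of_nonneg (by linarith),
        abs_of_neg (by linarith)]
      linarith

theorem add_pow_four_le (u v : ℝ) : (u + v) ^ 4 ≤ 8 * (u ^ 4 + v ^ 4) := by
  nlinarith [sq_nonneg (u - v), sq_nonneg (u ^ 2 - v ^ 2), sq_nonneg (u + v),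
    mul_nonneg (sq_nonneg (u - v)) (sq_nonneg (u + v)),
    mul_nonneg (sq_nonneg (u - v)) (sq_nonneg (u - v))]

end Gain

/-! ### Bias of one level, and of a clipped difference of levels. -/

section Levels

variable {S T : Type*} [Fintype S] [DecidableEq S] [Fintype T] [DecidableEq T] {n : ℕ}
  (s₀ : S) (t₀ : T) (φ : S → Fin n) (ψ : T → Fin n)
  (A : Matrix.unitaryGroup S ℂ) (B : Matrix.unitaryGroup T ℂ)

/-- The gain of the element `x`. -/
noncomputable def trueGain (x : Fin n) : ℝ := gain n √(outDist A s₀ φ x) √(outDist B t₀ ψ x)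

/-- The expectation of the gain that is estimated with a clock of size `m`. -/
noncomputable def levelMean (m : ℕ) (hm : 0 < m) : ℝ :=
  jointMean (phaseClock m hm) s₀ t₀ φ ψ (fun y y' => gain n (rootEst m y) (rootEst m y')) A B

/-- The weight cancels the denominator, and max(d, 0) = (|d| + d)/2; the linear parts sum to zero
since both distributions have mass 1. -/
theorem sum_mul_trueGain : ∑ x, (outDist A s₀ φ x + (n : ℝ)⁻¹) / 2 * trueGain s₀ t₀ φ ψ A B x =
    tvDist (outDist A s₀ φ) (outDist B t₀ ψ) := by
  have hn : (0 : ℝ) < (n : ℝ)⁻¹ := by have := (φ s₀).pos; positivity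
  have h1 : ∀ x, (outDist A s₀ φ x + (n : ℝ)⁻¹) / 2 * trueGain s₀ t₀ φ ψ A B x =
      1 / 2 * |outDist A s₀ φ x - outDist B t₀ ψ x| +
        1 / 2 * (outDist A s₀ φ x - outDist B t₀ ψ x) := by
    intro x
    have hp := outDist_nonneg A s₀ φ x
    rw [trueGain, gain, Real.sq_sqrt hp, Real.sq_sqrt (outDist_nonneg B t₀ ψ x)]
    have h2 : ∀ d : ℝ, max d 0 = 1 / 2 * |d| + 1 / 2 * d := by
      intro d
      rcases le_total 0 d with h | h
      · rw [max_eq_left h, abs_of_nonneg h]; ring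
      · rw [max_eq_right h, abs_of_nonpos h]; ring
    rw [← h2]
    have hr : outDist A s₀ φ x + (n : ℝ)⁻¹ ≠ 0 := by positivity
    generalize outDist A s₀ φ x + (n : ℝ)⁻¹ = r at hr
    field_simp
  simp only [h1]
  rw [Finset.sum_add_distrib, ← Finset.mul_sum, ← Finset.mul_sum, Finset.sum_sub_distrib,
    sum_outDist, sum_outDist, tvDist]
  ring

/-- The Lipschitz constant contributes (2√n)⁴ = 16n², splitting the two errors a factor 8, and each
of them 2187/m⁴. -/
theorem sum_joint_gain_sub_pow_four_le (m : ℕ) (hm : 0 < m) :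
    ∑ x, ∑ y, ∑ y', joint (phaseClock m hm) s₀ t₀ φ ψ A B x y y' *
      (gain n (rootEst m y) (rootEst m y') - trueGain s₀ t₀ φ ψ A B x) ^ 4 ≤
      559872 * (n : ℝ) ^ 2 / (m : ℝ) ^ 4 := by
  have hn := (φ s₀).pos
  have hn4 : √(n : ℝ) ^ 4 = (n : ℝ) ^ 2 := by
    rw [show 4 = 2 * 2 from rfl, pow_mul, Real.sq_sqrt (Nat.cast_nonneg n)]
  calc _ ≤ ∑ x, (128 * (n : ℝ) ^ 2) * ∑ y, ∑ y', (joint (phaseClock m hm) s₀ t₀ φ ψ A B x y y' *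
        (rootEst m y - √(outDist A s₀ φ x)) ^ 4 + joint (phaseClock m hm) s₀ t₀ φ ψ A B x y y' *
        (rootEst m y' - √(outDist B t₀ ψ x)) ^ 4) := by
        simp only [Finset.mul_sum]
        refine Finset.sum_le_sum fun x _ => Finset.sum_le_sum fun y _ =>
          Finset.sum_le_sum fun y' _ => ?_
        have hj := joint_nonneg (phaseClock m hm) s₀ t₀ φ ψ A B x y y'
        have h1 := abs_gain_sub_gain_le hn (rootEst_nonneg m y) (Real.sqrt_nonneg (outDist A s₀ φ x))
          (rootEst_nonneg m y') (Real.sqrt_nonneg (outDist B t₀ ψ x))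
        have h2 : (gain n (rootEst m y) (rootEst m y') - trueGain s₀ t₀ φ ψ A B x) ^ 4 ≤
            128 * (n : ℝ) ^ 2 * ((rootEst m y - √(outDist A s₀ φ x)) ^ 4 +
              (rootEst m y' - √(outDist B t₀ ψ x)) ^ 4) := by
          have he : Even 4 := by decide
          rw [← he.pow_abs, ← he.pow_abs (rootEst m y - _), ← he.pow_abs (rootEst m y' - _)]
          calc _ ≤ (2 * √n * (|rootEst m y - √(outDist A s₀ φ x)| +
                |rootEst m y' - √(outDist B t₀ ψ x)|)) ^ 4 := by
                gcongr
                exact h1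
            _ = 16 * (n : ℝ) ^ 2 * (|rootEst m y - √(outDist A s₀ φ x)| +
                |rootEst m y' - √(outDist B t₀ ψ x)|) ^ 4 := by
                rw [mul_pow, mul_pow, hn4]; norm_num
            _ ≤ 16 * (n : ℝ) ^ 2 * (8 * (|rootEst m y - √(outDist A s₀ φ x)| ^ 4 +
                |rootEst m y' - √(outDist B t₀ ψ x)| ^ 4)) := by
                gcongr; exact add_pow_four_le _ _
            _ = _ := by ring
        refine (mul_le_mul_of_nonneg_left h2 hj).trans (le_of_eq (by ring))
    _ ≤ ∑ x, (128 * (n : ℝ) ^ 2) * (2 * (2187 / (m : ℝ) ^ 4) *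
        ((outDist A s₀ φ x + (n : ℝ)⁻¹) / 2)) := by
        refine Finset.sum_le_sum fun x _ => mul_le_mul_of_nonneg_left ?_ (by positivity)
        simp only [Finset.sum_add_distrib]
        linarith [sum_joint_fst s₀ t₀ φ ψ A B m hm x, sum_joint_snd s₀ t₀ φ ψ A B m hm x]
    _ = _ := by
        rw [← Finset.mul_sum, ← Finset.mul_sum, sum_outDist_add_inv_div_two]
        ring

theorem abs_levelMean_sub_tvDist_le (m : ℕ) (hm : 0 < m) {κ : ℝ} (hκ : 0 < κ) :
    |levelMean s₀ t₀ φ ψ A B m hm - tvDist (outDist A s₀ φ) (outDist B t₀ ψ)| ≤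
      κ + 559872 * (n : ℝ) ^ 2 / (m : ℝ) ^ 4 / κ ^ 3 := by
  have h1 : levelMean s₀ t₀ φ ψ A B m hm - tvDist (outDist A s₀ φ) (outDist B t₀ ψ) =
      ∑ x, ∑ y, ∑ y', joint (phaseClock m hm) s₀ t₀ φ ψ A B x y y' *
        (gain n (rootEst m y) (rootEst m y') - trueGain s₀ t₀ φ ψ A B x) := by
    rw [← sum_mul_trueGain, levelMean, jointMean]
    simp only [← sum_joint (phaseClock m hm) s₀ t₀ φ ψ A B, Finset.sum_mul, mul_sub,
      Finset.sum_sub_distrib]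
  rw [h1]
  calc _ ≤ ∑ x, ∑ y, ∑ y', (joint (phaseClock m hm) s₀ t₀ φ ψ A B x y y' * κ +
        joint (phaseClock m hm) s₀ t₀ φ ψ A B x y y' *
        (gain n (rootEst m y) (rootEst m y') - trueGain s₀ t₀ φ ψ A B x) ^ 4 * (κ ^ 3)⁻¹) := by
        refine (Finset.abs_sum_le_sum_abs _ _).trans (Finset.sum_le_sum fun x _ => ?_)
        refine (Finset.abs_sum_le_sum_abs _ _).trans (Finset.sum_le_sum fun y _ => ?_)
        refine (Finset.abs_sum_le_sum_abs _ _).trans (Finset.sum_le_sum fun y' _ => ?_)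
        have hj := joint_nonneg (phaseClock m hm) s₀ t₀ φ ψ A B x y y'
        rw [abs_mul, abs_of_nonneg hj, mul_assoc, ← mul_add, ← div_eq_mul_inv]
        exact mul_le_mul_of_nonneg_left (abs_le_add_pow_four_div _ hκ) hj
    _ ≤ _ := by
        simp only [Finset.sum_add_distrib, ← Finset.sum_mul, sum_joint,
          sum_outDist_add_inv_div_two, one_mul]
        rw [div_eq_mul_inv _ (κ ^ 3)]
        gcongr
        exact sum_joint_gain_sub_pow_four_le s₀ t₀ φ ψ A B m hm

/-- Both levels are read from the same sample by a product clock and are compared with the same true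
gain, so the fourth moment of their difference, and with it the clipping bias, is governed by the
coarser level. -/
theorem abs_jointMean_clip_sub_le {m m' : ℕ} (hm : 0 < m) (hm' : 0 < m') (hmm : m ≤ m') {κ : ℝ}
    (hκ : 0 < κ) :
    |jointMean ((phaseClock m hm).prod (phaseClock m' hm')) s₀ t₀ φ ψ
      (fun y y' => clip κ (gain n (rootEst m' y.2) (rootEst m' y'.2) -
        gain n (rootEst m y.1) (rootEst m y'.1))) A B -
      (levelMean s₀ t₀ φ ψ A B m' hm' - levelMean s₀ t₀ φ ψ A B m hm)| ≤
      16 * (559872 * (n : ℝ) ^ 2 / (m : ℝ) ^ 4) / κ ^ 3 := by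
  set K := (phaseClock m hm).prod (phaseClock m' hm') with hK
  have e1 : levelMean s₀ t₀ φ ψ A B m hm = ∑ x, ∑ y, ∑ y', joint K s₀ t₀ φ ψ A B x y y' *
      gain n (rootEst m y.1) (rootEst m y'.1) := by
    rw [levelMean, jointMean]
    exact Finset.sum_congr rfl fun x _ => (sum_joint_prod_fst _ _ s₀ t₀ φ ψ A B
      (fun y y' => gain n (rootEst m y) (rootEst m y')) x).symm
  have e2 : levelMean s₀ t₀ φ ψ A B m' hm' = ∑ x, ∑ y, ∑ y', joint K s₀ t₀ φ ψ A B x y y' *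
      gain n (rootEst m' y.2) (rootEst m' y'.2) := by
    rw [levelMean, jointMean]
    exact Finset.sum_congr rfl fun x _ => (sum_joint_prod_snd _ _ s₀ t₀ φ ψ A B
      (fun y y' => gain n (rootEst m' y) (rootEst m' y')) x).symm
  have e3 : ∑ x, ∑ y, ∑ y', joint K s₀ t₀ φ ψ A B x y y' *
      (gain n (rootEst m y.1) (rootEst m y'.1) - trueGain s₀ t₀ φ ψ A B x) ^ 4 ≤
      559872 * (n : ℝ) ^ 2 / (m : ℝ) ^ 4 := by
    refine le_of_eq_of_le (Finset.sum_congr rfl fun x _ => ?_)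
      (sum_joint_gain_sub_pow_four_le s₀ t₀ φ ψ A B m hm)
    exact sum_joint_prod_fst _ _ s₀ t₀ φ ψ A B
      (fun y y' => (gain n (rootEst m y) (rootEst m y') - trueGain s₀ t₀ φ ψ A B x) ^ 4) x
  have e4 : ∑ x, ∑ y, ∑ y', joint K s₀ t₀ φ ψ A B x y y' *
      (gain n (rootEst m' y.2) (rootEst m' y'.2) - trueGain s₀ t₀ φ ψ A B x) ^ 4 ≤
      559872 * (n : ℝ) ^ 2 / (m : ℝ) ^ 4 := by
    refine le_trans (le_of_eq_of_le (Finset.sum_congr rfl fun x _ => ?_)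
      (sum_joint_gain_sub_pow_four_le s₀ t₀ φ ψ A B m' hm')) ?_
    · exact sum_joint_prod_snd _ _ s₀ t₀ φ ψ A B
        (fun y y' => (gain n (rootEst m' y) (rootEst m' y') - trueGain s₀ t₀ φ ψ A B x) ^ 4) x
    · gcongr
  rw [jointMean, e1, e2]
  simp only [← Finset.sum_sub_distrib, ← mul_sub]
  calc _ ≤ ∑ x, ∑ y, ∑ y', (joint K s₀ t₀ φ ψ A B x y y' *
        (gain n (rootEst m' y.2) (rootEst m' y'.2) - trueGain s₀ t₀ φ ψ A B x) ^ 4 *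
          (8 * (κ ^ 3)⁻¹) + joint K s₀ t₀ φ ψ A B x y y' *
        (gain n (rootEst m y.1) (rootEst m y'.1) - trueGain s₀ t₀ φ ψ A B x) ^ 4 *
          (8 * (κ ^ 3)⁻¹)) := by
        refine (Finset.abs_sum_le_sum_abs _ _).trans (Finset.sum_le_sum fun x _ => ?_)
        refine (Finset.abs_sum_le_sum_abs _ _).trans (Finset.sum_le_sum fun y _ => ?_)
        refine (Finset.abs_sum_le_sum_abs _ _).trans (Finset.sum_le_sum fun y' _ => ?_)
        have hj := joint_nonneg K s₀ t₀ φ ψ A B x y y'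
        rw [abs_mul, abs_of_nonneg hj]
        refine (mul_le_mul_of_nonneg_left (abs_clip_sub_le _ hκ) hj).trans ?_
        set u := gain n (rootEst m' y.2) (rootEst m' y'.2)
        set v := gain n (rootEst m y.1) (rootEst m y'.1)
        set w := trueGain s₀ t₀ φ ψ A B x
        have h1 := add_pow_four_le (u - w) (w - v)
        rw [sub_add_sub_cancel, show (w - v) ^ 4 = (v - w) ^ 4 by ring] at h1
        calc _ ≤ joint K s₀ t₀ φ ψ A B x y y' * (8 * ((u - w) ^ 4 + (v - w) ^ 4) / κ ^ 3) := by
              gcongr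
          _ = _ := by rw [div_eq_mul_inv]; ring
    _ ≤ _ := by
        simp only [Finset.sum_add_distrib, ← Finset.sum_mul]
        have h0 : 0 ≤ 8 * (κ ^ 3)⁻¹ := by positivity
        have h1 := mul_le_mul_of_nonneg_right e3 h0
        have h2 := mul_le_mul_of_nonneg_right e4 h0
        refine (add_le_add h2 h1).trans (le_of_eq ?_)
        rw [div_eq_mul_inv _ (κ ^ 3)]
        ring

end Levels

/-! ### Choice of the levels: constant success probability. -/

section Base

variable {S T : Type*} [Fintype S] [DecidableEq S] [Fintype T] [DecidableEq T] {n : ℕ}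
  (s₀ : S) (t₀ : T) (φ : S → Fin n) (ψ : T → Fin n)

theorem mul_jointMean_add {C : Type} [Fintype C] [DecidableEq C] (κ : Clock C) (f : C → C → ℝ)
    (c d : ℝ) (A : Matrix.unitaryGroup S ℂ) (B : Matrix.unitaryGroup T ℂ) :
    c * jointMean κ s₀ t₀ φ ψ f A B + d =
      jointMean κ s₀ t₀ φ ψ (fun y y' => c * f y y' + d) A B := by
  have h : d = ∑ x, ∑ y, ∑ y', joint κ s₀ t₀ φ ψ A B x y y' * d := by
    simp only [← Finset.sum_mul, sum_joint, sum_outDist_add_inv_div_two, one_mul]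
  conv_lhs => rw [h]
  simp only [jointMean, Finset.mul_sum, ← Finset.sum_add_distrib]
  refine Finset.sum_congr rfl fun x _ => Finset.sum_congr rfl fun y _ =>
    Finset.sum_congr rfl fun y' _ => ?_
  ring

/-- A variable with values in `[-κ, κ]` is rescaled to `[0, 1]`, so relative precision ε/κ suffices
and the outer estimation takes κ/ε calls instead of 1/ε. -/
theorem estimatesWithin_levelMean_sub {m m' mo : ℕ} (hm : 0 < m) (hm' : 0 < m') (hmm : m ≤ m')
    {κ ε : ℝ} (hκ : 0 < κ) (hε : 0 < ε)
    (h : 128 * 559872 * (n : ℝ) ^ 2 ≤ (m : ℝ) ^ 4 * κ ^ 3 * ε) (hmo : 1152 * κ ≤ mo * ε) :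
    ∃ k ≤ 462 * m' * mo, EstimatesWithin k (1 / 48) (ε / 4)
      fun A B => levelMean s₀ t₀ φ ψ A B m' hm' - levelMean s₀ t₀ φ ψ A B m hm := by
  have hm0 : (0 : ℝ) < m := by exact_mod_cast hm
  have hmo0 : 1 ≤ mo := by
    rcases Nat.eq_zero_or_pos mo with rfl | h
    · norm_num at hmo; linarith
    · exact h
  have h1 := estimatesWithin_jointMean ((phaseClock m hm).prod (phaseClock m' hm')) s₀ t₀ φ ψ
    (4 * m + 4 * m' + 2) (fun t => by simp only [Clock.prod, phaseClock]; omega)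
    (fun y y' => (2 * κ)⁻¹ * clip κ (gain n (rootEst m' y.2) (rootEst m' y'.2) -
      gain n (rootEst m y.1) (rootEst m y'.1)) + 1 / 2)
    (fun y y' => by
      have h2 := neg_le_clip κ (gain n (rootEst m' y.2) (rootEst m' y'.2) -
        gain n (rootEst m y.1) (rootEst m y'.1))
      have h3 := mul_le_mul_of_nonneg_left h2 (by positivity : 0 ≤ (2 * κ)⁻¹)
      have h4 : (2 * κ)⁻¹ * -κ = -(1 / 2) := by field_simp
      linarith)
    (fun y y' => by
      have h2 := clip_le hκ.le (gain n (rootEst m' y.2) (rootEst m' y'.2) -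
        gain n (rootEst m y.1) (rootEst m y'.1))
      have h3 := mul_le_mul_of_nonneg_left h2 (by positivity : 0 ≤ (2 * κ)⁻¹)
      have h4 : (2 * κ)⁻¹ * κ = 1 / 2 := by field_simp
      linarith)
    -- Scaling back by `2 * κ` gives ε/8; the clipping bias, bounded through `h`, is the other ε/8.
    (lam := ε / (16 * κ)) (by positivity) (m := mo) (by
      rw [← mul_div_assoc, le_div_iff₀ (by positivity)]; linarith)
  refine ⟨_, ?_, (h1.affine (2 * κ) (-κ)).mono le_rfl fun A B => ?_⟩
  -- 462 = 42 · 11, from 2 + 4(4m + 4m' + 2) ≤ 42m' and 8mo + 3 ≤ 11mo.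
  · nlinarith [Nat.mul_le_mul hm' hmo0, Nat.mul_le_mul hmm (le_refl mo),
      Nat.mul_le_mul hm' (le_refl mo), Nat.mul_le_mul (le_refl m') hmo0]
  · have h2 := abs_jointMean_clip_sub_le s₀ t₀ φ ψ A B hm hm' hmm hκ
    have h3 : 16 * (559872 * (n : ℝ) ^ 2 / (m : ℝ) ^ 4) / κ ^ 3 ≤ ε / 8 := by
      rw [div_le_iff₀ (by positivity), mul_div_assoc', div_le_iff₀ (by positivity)]
      linarith
    have h4 : |2 * κ| * (ε / (16 * κ)) = ε / 8 := by
      rw [abs_of_pos (by positivity)]; field_simp; norm_num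
    have h5 : ∀ d : ℝ, 2 * κ * ((2 * κ)⁻¹ * d + 1 / 2) + -κ = d := by
      intro d; field_simp; ring
    rw [mul_jointMean_add, h4]
    simp only [h5]
    linarith

theorem estimatesWithin_levelMean {m mo : ℕ} (hm : 0 < m) {ε : ℝ} (hε : 0 < ε)
    (hmo : 1152 ≤ mo * ε) :
    ∃ k ≤ 462 * m * mo, EstimatesWithin k (1 / 48) (ε / 8)
      fun A B => levelMean s₀ t₀ φ ψ A B m hm := by
  have hn := (φ s₀).pos
  have hmo0 : 1 ≤ mo := by
    rcases Nat.eq_zero_or_pos mo with rfl | h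
    · norm_num at hmo
    · exact h
  have h1 := estimatesWithin_jointMean (phaseClock m hm) s₀ t₀ φ ψ
    (4 * m + 1) (fun t => by simp only [phaseClock]; omega)
    (fun y y' => (1 / 2) * gain n (rootEst m y) (rootEst m y') + 0)
    (fun y y' => by linarith [gain_nonneg n (rootEst m y) (rootEst m y')])
    (fun y y' => by linarith [gain_le_two hn (rootEst m y) (rootEst m y')])
    (lam := ε / 16) (by positivity) (m := mo) (by linarith)
  refine ⟨_, ?_, (h1.affine 2 0).mono le_rfl fun A B => ?_⟩
  · nlinarith [Nat.mul_le_mul hm hmo0, Nat.mul_le_mul hm (le_refl mo),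
      Nat.mul_le_mul (le_refl m) hmo0]
  · rw [mul_jointMean_add, levelMean, abs_of_pos (by norm_num : (0 : ℝ) < 2)]
    have h5 : ∀ d : ℝ, 2 * ((1 / 2) * d + 0) + 0 = d := by intro d; ring
    simp only [h5, sub_self, abs_zero]
    linarith

theorem ceil_mul_le {c x : ℝ} (hc : 0 ≤ c) (hx : 1 ≤ x) : (⌈c * x⌉₊ : ℝ) ≤ (c + 1) * x := by
  have := Nat.ceil_lt_add_one (a := c * x) (by positivity)
  linarith

/-- With ε = η⁶ all exponents are integers. The inner sizes √n/η³, √n/η⁵, √n/η⁶ meet the outer sizes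
1/η⁶, 1/η⁴, 1/η³, and each product is √n/η⁹ = √n/ε^{3/2}. The clipping levels are κ = η² and η³. -/
theorem exists_estimatesWithin_tvDist_pow {η : ℝ} (h0 : 0 < η) (h1 : η ≤ 1) :
    ∃ k : ℕ, (k : ℝ) ≤ 3 * 462 * 257 * 1153 * (√n / η ^ 9) ∧
      EstimatesWithin k (1 / 16) (η ^ 6)
        fun A B => tvDist (outDist A s₀ φ) (outDist B t₀ ψ) := by
  have hn := (φ s₀).pos
  set s := √(n : ℝ) with hs
  have hs1 : 1 ≤ s := Real.one_le_sqrt.2 (by exact_mod_cast hn)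
  have hs4 : s ^ 4 = (n : ℝ) ^ 2 := by
    rw [hs, show 4 = 2 * 2 from rfl, pow_mul, Real.sq_sqrt (Nat.cast_nonneg n)]
  have hpow : ∀ i : ℕ, 1 ≤ 1 / η ^ i := fun i => by
    rw [le_div_iff₀ (by positivity), one_mul]; exact pow_le_one₀ h0.le h1
  have hspow : ∀ i : ℕ, 1 ≤ s / η ^ i := fun i => by
    rw [le_div_iff₀ (by positivity), one_mul]; exact (pow_le_one₀ h0.le h1).trans hs1
  -- 256⁴ = 2³² exceeds both 128 · 559872 (clipping) and 4096 · 559872 (bias of the last level);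
  -- 1152 = 16 · 72 is the outer precision.
  let M : ℕ → ℕ := fun i => ⌈256 * (s / η ^ i)⌉₊
  let N : ℕ → ℕ := fun i => ⌈1152 * (1 / η ^ i)⌉₊
  have hM0 : ∀ i, 0 < M i := fun i => Nat.ceil_pos.2 (by linarith [hspow i])
  have hMη : ∀ i, (2 : ℝ) ^ 32 * (n : ℝ) ^ 2 ≤ ((M i : ℝ) * η ^ i) ^ 4 := fun i => by
    have h2 : 256 * s ≤ M i * η ^ i := by
      have := Nat.le_ceil (256 * (s / η ^ i))
      rwa [← mul_div_assoc, div_le_iff₀ (by positivity), mul_div_assoc] at this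
    calc (2 : ℝ) ^ 32 * (n : ℝ) ^ 2 = (256 * s) ^ 4 := by rw [mul_pow, hs4]; norm_num
      _ ≤ _ := by gcongr
  have hNη : ∀ i, 1152 ≤ (N i : ℝ) * η ^ i := fun i => by
    calc (1152 : ℝ) = 1152 * (1 / η ^ i) * η ^ i := by field_simp
      _ ≤ N i * η ^ i := mul_le_mul_of_nonneg_right (Nat.le_ceil _) (by positivity)
  have hMM : ∀ i j, i ≤ j → M i ≤ M j := fun i j hij => by
    apply Nat.ceil_mono
    gcongr 256 * (s / ?_)
    exact pow_le_pow_of_le_one h0.le h1 hij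
  have hcost : ∀ k i j, i + j = 9 → k ≤ 462 * M i * N j →
      (k : ℝ) ≤ 462 * 257 * 1153 * (s / η ^ 9) := fun k i j hij hk => by
    have h2 := ceil_mul_le (c := 256) (by norm_num) (hspow i)
    have h3 := ceil_mul_le (c := 1152) (by norm_num) (hpow j)
    calc (k : ℝ) ≤ 462 * M i * N j := by exact_mod_cast hk
      _ ≤ 462 * ((256 + 1) * (s / η ^ i)) * ((1152 + 1) * (1 / η ^ j)) := by gcongr
      _ = _ := by rw [← hij, pow_add]; field_simp; norm_num
  obtain ⟨k0, hk0, e0⟩ := estimatesWithin_levelMean s₀ t₀ φ ψ (hM0 3) (mo := N 6)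
    (pow_pos h0 6) (hNη 6)
  obtain ⟨k1, hk1, e1⟩ := estimatesWithin_levelMean_sub s₀ t₀ φ ψ (hM0 3) (hM0 5)
    (hMM 3 5 (by norm_num)) (mo := N 4) (pow_pos h0 2) (pow_pos h0 6)
    (by
      have := hMη 3
      calc _ ≤ (2 : ℝ) ^ 32 * (n : ℝ) ^ 2 := by gcongr; norm_num
        _ ≤ _ := this
        _ = _ := by ring)
    (by
      have := mul_le_mul_of_nonneg_right (hNη 4) (sq_nonneg η)
      calc _ ≤ _ := this
        _ = _ := by ring)
  -- Here the clipping condition has slack: it asks for η¹⁵ where η²⁰ would do.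
  obtain ⟨k2, hk2, e2⟩ := estimatesWithin_levelMean_sub s₀ t₀ φ ψ (hM0 5) (hM0 6)
    (hMM 5 6 (by norm_num)) (mo := N 3) (pow_pos h0 3) (pow_pos h0 6)
    (by
      have := hMη 5
      calc _ ≤ (2 : ℝ) ^ 32 * (n : ℝ) ^ 2 := by gcongr; norm_num
        _ ≤ _ := this
        _ = (M 5 : ℝ) ^ 4 * η ^ 20 := by ring
        _ ≤ (M 5 : ℝ) ^ 4 * η ^ 15 := by
            gcongr ?_ * ?_
            exact pow_le_pow_of_le_one h0.le h1 (by norm_num)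
        _ = _ := by ring)
    (by
      have := mul_le_mul_of_nonneg_right (hNη 3) (pow_pos h0 3).le
      calc _ ≤ _ := this
        _ = _ := by ring)
  -- Failure 3/48. Error: ε/8 + ε/4 + ε/4 from the three estimates and ε/4 from the bias of the
  -- finest level.
  refine ⟨k0 + k1 + k2, ?_, ((e0.add e1).add e2).mono (by norm_num) fun A B => ?_⟩
  · have c0 := hcost k0 3 6 rfl hk0
    have c1 := hcost k1 5 4 rfl hk1
    have c2 := hcost k2 6 3 rfl hk2
    push_cast
    linarith
  · have h2 := abs_levelMean_sub_tvDist_le s₀ t₀ φ ψ A B (M 6) (hM0 6)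
      (κ := η ^ 6 / 8) (by positivity)
    have h3 : 559872 * (n : ℝ) ^ 2 / (M 6 : ℝ) ^ 4 / (η ^ 6 / 8) ^ 3 ≤ η ^ 6 / 8 := by
      have hMpos : (0 : ℝ) < M 6 := by exact_mod_cast hM0 6
      rw [div_le_iff₀ (by positivity), div_le_iff₀ (by positivity)]
      have h4 : η ^ 6 / 8 * (η ^ 6 / 8) ^ 3 * (M 6 : ℝ) ^ 4 = ((M 6 : ℝ) * η ^ 6) ^ 4 / 4096 := by
        ring
      rw [h4, le_div_iff₀ (by norm_num)]
      refine le_trans ?_ (hMη 6)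
      nlinarith [sq_nonneg (n : ℝ)]
    rw [show levelMean s₀ t₀ φ ψ A B (M 3) (hM0 3) + (levelMean s₀ t₀ φ ψ A B (M 5) (hM0 5) -
      levelMean s₀ t₀ φ ψ A B (M 3) (hM0 3)) + (levelMean s₀ t₀ φ ψ A B (M 6) (hM0 6) -
      levelMean s₀ t₀ φ ψ A B (M 5) (hM0 5)) = levelMean s₀ t₀ φ ψ A B (M 6) (hM0 6) by ring]
    linarith [pow_pos h0 6]

theorem exists_estimatesWithin_tvDist {ε : ℝ} (h0 : 0 < ε) (h1 : ε ≤ 1) :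
    ∃ k : ℕ, (k : ℝ) ≤ 3 * 462 * 257 * 1153 * (√n / ε ^ (3 / 2 : ℝ)) ∧
      EstimatesWithin k (1 / 16) ε fun A B => tvDist (outDist A s₀ φ) (outDist B t₀ ψ) := by
  have h := exists_estimatesWithin_tvDist_pow s₀ t₀ φ ψ (Real.rpow_pos_of_pos h0 (1 / 6))
    (Real.rpow_le_one h0.le h1 (by norm_num))
  rw [← Real.rpow_mul_natCast h0.le, ← Real.rpow_mul_natCast h0.le] at h
  norm_num at h ⊢
  exact h

theorem abs_half_sub_tvDist_le (A : Matrix.unitaryGroup S ℂ) (B : Matrix.unitaryGroup T ℂ) :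
    |1 / 2 - tvDist (outDist A s₀ φ) (outDist B t₀ ψ)| ≤ 1 / 2 := by
  have h1 : ∑ x, |outDist A s₀ φ x - outDist B t₀ ψ x| ≤ 2 := by
    calc _ ≤ ∑ x, (outDist A s₀ φ x + outDist B t₀ ψ x) := by
          refine Finset.sum_le_sum fun x _ => abs_le.2 ⟨?_, ?_⟩ <;>
            linarith [outDist_nonneg A s₀ φ x, outDist_nonneg B t₀ ψ x]
      _ = 2 := by rw [Finset.sum_add_distrib, sum_outDist, sum_outDist]; norm_num
  have h2 : 0 ≤ ∑ x, |outDist A s₀ φ x - outDist B t₀ ψ x| :=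
    Finset.sum_nonneg fun _ _ => abs_nonneg _
  unfold tvDist
  rw [abs_le]
  constructor <;> linarith

end Base

/-! ### All ε and δ, and the comparison of the bounds. -/

section Main

variable {S T : Type*} [Fintype S] [DecidableEq S] [Fintype T] [DecidableEq T] {n : ℕ}

/-- The claimed bound is small for ε or δ near 1, so these ranges need cheaper algorithms than
repetition. Elsewhere log(1/ε) ≥ 1/2 is all that is used of this factor. -/
theorem exists_estimatesWithin_tvDist_of_failure (s₀ : S) (t₀ : T) (φ : S → Fin n) (ψ : T → Fin n)
    {ε δ : ℝ} (hε0 : 0 < ε) (hε1 : ε < 1) (hδ0 : 0 < δ) (hδ1 : δ < 1) :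
    ∃ k : ℕ, (k : ℝ) ≤ 48 * (3 * 462 * 257 * 1153) *
      (√n / ε ^ (3 / 2 : ℝ) * Real.log (1 / ε) * Real.log (1 / δ)) ∧
      EstimatesWithin k δ ε fun A B => tvDist (outDist A s₀ φ) (outDist B t₀ ψ) := by
  have : Nonempty S := ⟨s₀⟩
  have : Nonempty T := ⟨t₀⟩
  have hlogδ : 1 - δ ≤ Real.log (1 / δ) := by
    have := Real.one_sub_inv_le_log_of_pos (show 0 < 1 / δ by positivity)
    rw [one_div, inv_inv] at this
    rwa [one_div]
  have hlogδ0 : 0 ≤ Real.log (1 / δ) := by linarith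
  have hlogε0 : 0 ≤ Real.log (1 / ε) := Real.log_nonneg (by rw [le_div_iff₀ hε0]; linarith)
  have hε32 : 0 < ε ^ (3 / 2 : ℝ) := Real.rpow_pos_of_pos hε0 _
  set Y := √(n : ℝ) / ε ^ (3 / 2 : ℝ) with hY
  have hY0 : 0 ≤ Y := by positivity
  -- The distance lies in [0, 1], so the constant 1/2 is good enough.
  rcases le_or_gt (1 / 2) ε with hε | hε
  · refine ⟨0, by simp only [Nat.cast_zero]; positivity, ?_⟩
    exact (EstimatesWithin.const (c := 1 / 2) (abs_half_sub_tvDist_le s₀ t₀ φ ψ)).mono hδ0.le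
      fun A B => by simpa using hε
  have hlogε : 1 / 2 ≤ Real.log (1 / ε) := by
    have := Real.one_sub_inv_le_log_of_pos (show 0 < 1 / ε by positivity)
    rw [one_div, inv_inv] at this
    rw [one_div ε]
    linarith
  rcases le_or_gt δ (3 / 4) with hδ | hδ
  -- Precision ε/2, because repetition doubles the error. As δ ≤ 3/4 gives log(1/δ) ≥ 1/4, the
  -- rounding up in the number of repetitions is absorbed.
  · obtain ⟨k, hk, he⟩ := exists_estimatesWithin_tvDist s₀ t₀ φ ψ (ε := ε / 2) (by positivity)
      (by linarith)
    have hr := he.repeat le_rfl ⌈2 * Real.log (1 / δ)⌉₊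
    refine ⟨_, ?_, hr.mono ?_ fun A B => by simp; linarith⟩
    · have h1 : (⌈2 * Real.log (1 / δ)⌉₊ : ℝ) ≤ 6 * Real.log (1 / δ) := by
        have := Nat.ceil_lt_add_one (a := 2 * Real.log (1 / δ)) (by positivity)
        linarith
      have h2 : √(n : ℝ) / (ε / 2) ^ (3 / 2 : ℝ) ≤ 4 * Y := by
        rw [Real.div_rpow hε0.le (by norm_num), hY, div_div_eq_mul_div, mul_comm, mul_div_assoc]
        gcongr
        calc (2 : ℝ) ^ (3 / 2 : ℝ) ≤ 2 ^ (2 : ℝ) :=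
              Real.rpow_le_rpow_of_exponent_le (by norm_num) (by norm_num)
          _ = 4 := by norm_num
      push_cast
      calc (⌈2 * Real.log (1 / δ)⌉₊ : ℝ) * k
          ≤ (6 * Real.log (1 / δ)) * (3 * 462 * 257 * 1153 * (4 * Y)) := by
            gcongr
            exact hk.trans (by gcongr)
        _ = 48 * (3 * 462 * 257 * 1153) * (Y * (1 / 2) * Real.log (1 / δ)) := by ring
        _ ≤ _ := by gcongr
    · have h1 := Nat.le_ceil (2 * Real.log (1 / δ))
      set R := ⌈2 * Real.log (1 / δ)⌉₊
      have h2 : (1 : ℝ) / 2 ≤ Real.log 2 := by linarith [Real.log_two_gt_d9]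
      rw [← Real.log_le_log_iff (by positivity) hδ0, Real.log_pow, one_div, Real.log_inv]
      rw [one_div, Real.log_inv] at h1
      nlinarith [Nat.cast_nonneg (α := ℝ) R]
  -- Success probability h is wanted at a cost proportional to h ≤ log(1/δ). Estimating only to
  -- precision mε with m about 7/(8h) saves a factor m^{3/2} ≥ m, and the random offset still
  -- succeeds with probability (15/16)/m ≥ h.
  · set h := 1 - δ with hh
    have hh0 : 0 < h := by linarith
    have hfl : 2 ≤ 7 / (8 * h) := by rw [le_div_iff₀ (by positivity)]; linarith
    have hm2 : 2 ≤ ⌊7 / (8 * h)⌋₊ := Nat.le_floor (by exact_mod_cast hfl)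
    have hm_le := Nat.floor_le (show 0 ≤ 7 / (8 * h) by positivity)
    have hm_gt := Nat.lt_floor_add_one (7 / (8 * h))
    set m := ⌊7 / (8 * h)⌋₊
    have hm0 : 0 < m := by omega
    have hm1 : (1 : ℝ) ≤ m := by exact_mod_cast hm0
    have hmh : h * m ≤ 7 / 8 := by
      rw [le_div_iff₀ (by positivity)] at hm_le
      linarith
    -- If mε is at least 1/2, the constant 1/2 is already the coarse estimate.
    rcases le_or_gt (1 / 2) (m * ε) with hmε | hmε
    · refine ⟨0, by simp only [Nat.cast_zero]; positivity, ?_⟩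
      have h1 : EstimatesWithin (S := S) (T := T) 0 0 (m * ε) fun A B =>
          tvDist (outDist A s₀ φ) (outDist B t₀ ψ) :=
        EstimatesWithin.const (c := 1 / 2) fun A B =>
          (abs_half_sub_tvDist_le s₀ t₀ φ ψ A B).trans hmε
      refine (h1.guess hε0 hm0).mono ?_ fun A B => by simp
      have : h ≤ (1 - 0) / m := by rw [le_div_iff₀ (by positivity)]; linarith
      linarith
    · obtain ⟨k, hk, he⟩ := exists_estimatesWithin_tvDist s₀ t₀ φ ψ (ε := m * ε) (by positivity)
        (by linarith)
      refine ⟨k, ?_, (he.guess hε0 hm0).mono ?_ fun A B => by simp⟩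
      · have h1 : √(n : ℝ) / (m * ε) ^ (3 / 2 : ℝ) ≤ Y * (3 * h) := by
          have h2 : (m : ℝ) ≤ (m : ℝ) ^ (3 / 2 : ℝ) := by
            conv_lhs => rw [← Real.rpow_one (m : ℝ)]
            exact Real.rpow_le_rpow_of_exponent_le hm1 (by norm_num)
          have h3 : 1 ≤ 3 * h * m := by
            rw [div_lt_iff₀ (by positivity)] at hm_gt
            nlinarith
          rw [Real.mul_rpow (by positivity) hε0.le, hY, div_mul_eq_mul_div,
            div_le_div_iff₀ (by positivity) hε32]
          calc √(n : ℝ) * ε ^ (3 / 2 : ℝ) = √(n : ℝ) * 1 * ε ^ (3 / 2 : ℝ) := by ring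
            _ ≤ √(n : ℝ) * (3 * h * (m : ℝ) ^ (3 / 2 : ℝ)) * ε ^ (3 / 2 : ℝ) := by
                gcongr
                exact h3.trans (by gcongr)
            _ = _ := by ring
        calc (k : ℝ) ≤ 3 * 462 * 257 * 1153 * (Y * (3 * h)) := hk.trans (by gcongr)
          _ = 6 * (3 * 462 * 257 * 1153) * (Y * (1 / 2) * h) := by ring
          _ ≤ 48 * (3 * 462 * 257 * 1153) * (Y * Real.log (1 / ε) * Real.log (1 / δ)) := by
              gcongr
              norm_num
      · have : h ≤ (1 - 1 / 16) / m := by rw [le_div_iff₀ (by positivity)]; linarith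
        linarith

/-- The crude bounds log(1/t) ≤ 1/t and ε^{3/2} ≥ ε² already bound the quotient by ε⁵δ⁴. -/
theorem isLittleO_samples (n : ℕ) :
    (fun z : ℝ × ℝ => √(n : ℝ) / z.1 ^ (3 / 2 : ℝ) * Real.log (1 / z.1) * Real.log (1 / z.2))
      =o[𝓝[>] (0 : ℝ) ×ˢ 𝓝[>] (0 : ℝ)]
    (fun z : ℝ × ℝ => √(n : ℝ) / (z.1 ^ 8 * z.2 ^ 5)) := by
  rw [Asymptotics.isLittleO_iff]
  intro c hc
  have h1 : ∀ᶠ z : ℝ × ℝ in 𝓝[>] (0 : ℝ) ×ˢ 𝓝[>] (0 : ℝ),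
      z ∈ Set.Ioo (0 : ℝ) (min c 1) ×ˢ Set.Ioo (0 : ℝ) 1 :=
    Filter.prod_mem_prod (Ioo_mem_nhdsGT (by positivity)) (Ioo_mem_nhdsGT one_pos)
  filter_upwards [h1] with z hz
  obtain ⟨x, y⟩ := z
  obtain ⟨⟨hx0, hx1⟩, hy0, hy1⟩ := hz
  simp only at hx0 hx1 hy0 hy1 ⊢
  have hxc : x < c := hx1.trans_le (min_le_left _ _)
  have hx1 : x < 1 := hx1.trans_le (min_le_right _ _)
  have hlog : ∀ t : ℝ, 0 < t → t < 1 → 0 ≤ Real.log (1 / t) ∧ Real.log (1 / t) ≤ 1 / t := by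
    intro t h0 h1
    refine ⟨Real.log_nonneg (by rw [le_div_iff₀ h0]; linarith), ?_⟩
    have := Real.log_le_sub_one_of_pos (show 0 < 1 / t by positivity)
    linarith
  obtain ⟨a1, a2⟩ := hlog x hx0 hx1
  obtain ⟨b1, b2⟩ := hlog y hy0 hy1
  have hx32 : x ^ 2 ≤ x ^ (3 / 2 : ℝ) := by
    rw [← Real.rpow_natCast]
    exact Real.rpow_le_rpow_of_exponent_ge hx0 hx1.le (by norm_num)
  have hp : 0 < x ^ (3 / 2 : ℝ) := Real.rpow_pos_of_pos hx0 _
  rw [Real.norm_of_nonneg (by positivity), Real.norm_of_nonneg (by positivity)]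
  calc _ ≤ √(n : ℝ) / x ^ 2 * (1 / x) * (1 / y) := by gcongr
    _ = x ^ 5 * y ^ 4 * (√(n : ℝ) / (x ^ 8 * y ^ 5)) := by field_simp
    _ ≤ c * (√(n : ℝ) / (x ^ 8 * y ^ 5)) := by
        gcongr
        calc x ^ 5 * y ^ 4 ≤ x * 1 := by
              gcongr
              · exact pow_le_of_le_one hx0.le hx1.le (by norm_num)
              · exact pow_le_one₀ hy0.le hy1.le
          _ ≤ c := by linarith

end Main

theorem mainTheorem8 :
    (∃ C : ℝ, 0 < C ∧
      ∀ (n : ℕ) (ε δ : ℝ), 0 < ε → ε < 1 → 0 < δ → δ < 1 →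
      ∀ (S T : Type*) [Fintype S] [DecidableEq S] [Fintype T] [DecidableEq T]
        (s₀ : S) (t₀ : T) (φ : S → Fin n) (ψ : T → Fin n),
      ∃ 𝒜 : QAlgorithm S T,
        (𝒜.numSamples : ℝ) ≤
          C * (√(n : ℝ) / ε ^ (3 / 2 : ℝ) * Real.log (1 / ε) * Real.log (1 / δ)) ∧
        ∀ p q : Fin n → ℝ, IsDistribution p → IsDistribution q →
        ∀ (A : Matrix.unitaryGroup S ℂ) (B : Matrix.unitaryGroup T ℂ),
          SamplesFrom A s₀ φ p → SamplesFrom B t₀ ψ q →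
          1 - δ ≤ 𝒜.outputProb A B {e | |e - tvDist p q| ≤ ε}) ∧
    (∀ n : ℕ,
      (fun z : ℝ × ℝ => √(n : ℝ) / z.1 ^ (3 / 2 : ℝ) * Real.log (1 / z.1) * Real.log (1 / z.2))
        =o[𝓝[>] (0 : ℝ) ×ˢ 𝓝[>] (0 : ℝ)]
      (fun z : ℝ × ℝ => √(n : ℝ) / (z.1 ^ 8 * z.2 ^ 5))) := by
  refine ⟨⟨48 * (3 * 462 * 257 * 1153), by norm_num, ?_⟩, isLittleO_samples⟩
  intro n ε δ hε0 hε1 hδ0 hδ1 S T _ _ _ _ s₀ t₀ φ ψ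
  obtain ⟨k, hk, h⟩ := exists_estimatesWithin_tvDist_of_failure s₀ t₀ φ ψ hε0 hε1 hδ0 hδ1
  obtain ⟨𝒜, h1, h2⟩ := h.exists_qAlgorithm
  refine ⟨𝒜, by rw [h1]; exact hk, fun p q _ _ A B hA hB => ?_⟩
  rw [hA.eq_outDist, hB.eq_outDist]
  exact h2 A B
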